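/- **Theorem 1 (Performance Bounds).** Let $d,n_a\ge 1$ and $n_{u_1},\dots,n_{u_{n_a}}\ge 1$ be integers. A task is a pair $(i,j)$ with $1\le i\le n_a$, $1\le j\le n_{u_i}$; let $n_u=\sum_i n_{u_i}$ be the number of tasks and $\tilde n=\sqrt{\sum_i n_{u_i}^2}$. For each task let $X^{(i,j)}\in\mathbb R^{n_{ij}\times d}$ be a fixed matrix all of whose columns have Euclidean norm $1$; put $n_{\min}=\min_{i,j}n_{ij}$ and let $X=\bigoplus_{i,j}X^{(i,j)}$ be the block diagonal matrix of the $X^{(i,j)}$. For $W=(\theta,P,U)$ with $\theta\in\mathbb R^d$, $P=[p^{(1)},\dots,p^{(n_a)}]\in\mathbb R^{d\times n_a}$ and $U=[u^{(i,j)}]_{(i,j)}\in\mathbb R^{d\times n_u}$, write $w^{(i,j)}=\theta+p^{(i)}+u^{(i,j)}$ and let $\overline W\in\mathbb R^{dn_u}$ be the vector obtained by stacking all $w^{(i,j)}$. Let $\|\cdot\|$ be the Euclidean norm, $\|\cdot\|_F$ the Frobenius norm, and $\|A\|_{1,2}$ the sum of the Euclidean norms of the rows of $A$. For a vector (matrix)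 $A$ let $\mathcal N(A)$ and $\mathcal N_\perp(A)$ be the index sets of its zero and nonzero entries (rows), and let $A^{\mathcal I}$ be the vector (matrix) of the entries (rows) of $A$ with index in $\mathcal I$. *Model.* Let $W^*=(\theta^*,P^*,U^*)$ be fixed, $\sigma\ge 0$, and $y^{(i,j)}=X^{(i,j)}w^{*(i,j)}+\delta^{(i,j)}$, where the noise vectors $\delta^{(i,j)}\sim\mathcal N(0,\sigma^2I)$ are independent over the tasks. Put $F=X\overline{W^*}$. Problem (P1) is to minimise over all $W=(\theta,P,U)$ $$\sum_{i,j}\bigl\|y^{(i,j)}-X^{(i,j)}w^{(i,j)}\bigr\|^2+\lambda_1\|\theta\|_1+\lambda_2\|P\|_{1,2}+\lambda_3\|U^\top\|_{1,2}.$$ *Assumption 1.* Let $n_\theta,n_p,n_{u,a}$ be natural numbers with $|\mathcal N_\perp(\theta^*)|\le n_\theta$, $|\mathcal N_\perp(P^*)|\le n_p$, $|\mathcal N_\perp(U^{*\top})|\le n_{u,a}$, and let $\beta_\theta,\beta_p,\beta_{u,a}>0$. Let $\mathcal K$ be the set of all triples $\Gamma=(\Gamma_\theta,\Gamma_P,\Gamma_U)\in\mathbb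 R^d\times\mathbb R^{d\times n_a}\times\mathbb R^{d\times n_u}$ with $$\|\Gamma_\theta^{\mathcal N(\theta^*)}\|_1\le\beta_\theta\|\Gamma_\theta^{\mathcal N_\perp(\theta^*)}\|_1,\qquad \|\Gamma_P^{\mathcal N(P^*)}\|_{1,2}\le\beta_p\|\Gamma_P^{\mathcal N_\perp(P^*)}\|_{1,2},\qquad \|(\Gamma_U^\top)^{\mathcal N(U^{*\top})}\|_{1,2}\le\beta_{u,a}\|(\Gamma_U^\top)^{\mathcal N_\perp(U^{*\top})}\|_{1,2},$$ and let $\Gamma_{\overline W}$ be the vector obtained by stacking the vectors $\Gamma_\theta+\Gamma_{p^{(i)}}+\Gamma_{u^{(i,j)}}$. Let $\kappa_\theta,\kappa_p,\kappa_{u,a}>0$ be lower bounds, over all $\Gamma\in\mathcal K$ for which the denominator is nonzero, of the respective quotients $$\frac{\|X\Gamma_{\overline W}\|}{\sqrt{n_{\min}n_u}\,\|\Gamma_\theta^{\mathcal N_\perp(\theta^*)}\|},\qquad \frac{\|X\Gamma_{\overline W}\|}{\sqrt{n_{\min}n_u}\,\|\Gamma_P^{\mathcal N_\perp(P^*)}\|_F},\qquad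 \frac{\|X\Gamma_{\overline W}\|}{\sqrt{n_{\min}n_u}\,\|(\Gamma_U^\top)^{\mathcal N_\perp(U^{*\top})}\|_F}$$ (for instance their minima, if these exist and are positive). *Conclusion.* Let $t>0$, $\alpha=2\sigma\sqrt{dn_u+t}$, $\lambda_1\ge n_u\alpha$, $\lambda_2\ge\tilde n\alpha$, $\lambda_3\ge\alpha$, and $$\zeta=\frac{\lambda_1\sqrt{n_\theta}}{\kappa_\theta}+\frac{\lambda_2\sqrt{n_p}}{\kappa_p}+\frac{\lambda_3\sqrt{n_{u,a}}}{\kappa_{u,a}},\qquad Z=t-dn_u\log\Bigl(1+\frac t{dn_u}\Bigr),\qquad \delta(t)=1-\frac{1}{\sqrt{2\pi Z}}\exp\Bigl(-\frac Z2\Bigr).$$ Let $\hat W=(\hat\theta,\hat P,\hat U)$ be any (random) optimal solution of (P1) whose estimation error $(\hat\theta-\theta^*,\hat P-P^*,\hat U-U^*)$ almost surely belongs to $\mathcal K$. Then each of the following four inequalities holds with probability at least $\delta(t)$: $$\frac{1}{n_{\min}n_u}\bigl\|X\overline{\hat W}-F\bigr\|^2\le\Bigl(\frac{2\zeta}{n_{\min}n_u}\Bigr)^2,\qquad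 \|\hat\theta-\theta^*\|_1\le\frac{2(\beta_\theta+1)\sqrt{n_\theta}}{\kappa_\theta n_{\min}n_u}\,\zeta,$$ $$\|\hat P-P^*\|_{1,2}\le\frac{2(\beta_p+1)\sqrt{n_p}}{\kappa_p n_{\min}n_u}\,\zeta,\qquad \|\hat U^\top-U^{*\top}\|_{1,2}\le\frac{2(\beta_{u,a}+1)\sqrt{n_{u,a}}}{\kappa_{u,a} n_{\min}n_u}\,\zeta.$$ -/

import Mathlib

open MeasureTheory ProbabilityTheory Matrix

noncomputable section

namespace MultiTask

/-! ### Norms and zero patterns -/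

/-- The `ℓ₁` norm of a real vector. -/
def l1 {m : Type*} [Fintype m] (v : m → ℝ) : ℝ := ∑ i, |v i|

/-- The `ℓ₂` norm of a real vector. -/
def l2 {m : Type*} [Fintype m] (v : m → ℝ) : ℝ := √(∑ i, v i ^ 2)

/-- The `ℓ_{1,2}` norm of a matrix: the sum of the `ℓ₂` norms of its rows. -/
def l12 {m k : Type*} [Fintype m] [Fintype k] (A : Matrix m k ℝ) : ℝ := ∑ i, l2 (A i)

/-- The Frobenius norm of a matrix. -/
def frob {m k : Type*} [Fintype m] [Fintype k] (A : Matrix m k ℝ) : ℝ :=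
  √(∑ i, ∑ j, A i j ^ 2)

open Classical in
/-- The index set of the zero entries of a vector, or of the zero rows of a matrix
(a matrix is the family of its rows). -/
def zeroSet {m : Type*} [Fintype m] {R : Type*} [Zero R] (A : m → R) : Finset m :=
  Finset.univ.filter fun i => A i = 0

open Classical in
/-- The index set of the nonzero entries of a vector, or of the nonzero rows of a matrix. -/
def nonzeroSet {m : Type*} [Fintype m] {R : Type*} [Zero R] (A : m → R) : Finset m :=
  Finset.univ.filter fun i => A i ≠ 0

/-- The vector of the entries of `v` with index in `s`. -/
def entries {m : Type*} (v : m → ℝ) (s : Finset m) : s → ℝ := fun i => v i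

/-- The matrix of the rows of `A` with index in `s`. -/
def rows {m k : Type*} (A : Matrix m k ℝ) (s : Finset m) : Matrix s k ℝ :=
  A.submatrix Subtype.val id

/-! ### The model -/

/-- A task is a pair (attribute `i`, user `j` of the attribute `i`). -/
abbrev Task {na : ℕ} (nu : Fin na → ℕ) : Type := Σ i : Fin na, Fin (nu i)

/-- A parameter triple `(θ, P, U)`: the columns of `P` are indexed by the attributes, those of
`U` by the tasks. -/
structure Params (d : ℕ) {na : ℕ} (nu : Fin na → ℕ) where
  θ : Fin d → ℝ
  P : Matrix (Fin d) (Fin na) ℝ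
  U : Matrix (Fin d) (Task nu) ℝ

variable {d na : ℕ} {nu : Fin na → ℕ} {n : Task nu → ℕ}

instance : Sub (Params d nu) := ⟨fun V W => ⟨V.θ - W.θ, V.P - W.P, V.U - W.U⟩⟩

/-- The weight vector `θ + p⁽ⁱ⁾ + u⁽ⁱʲ⁾` of the task `c = (i, j)`. -/
def Params.weight (W : Params d nu) (c : Task nu) : Fin d → ℝ :=
  fun l => W.θ l + W.P l c.1 + W.U l c

/-- All weight vectors stacked in one vector. -/
def Params.stack (W : Params d nu) : (Σ _ : Task nu, Fin d) → ℝ :=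
  fun k => W.weight k.1 k.2

/-- The direct sum (block diagonal matrix) of all feature matrices. -/
def bigX (X : ∀ c : Task nu, Matrix (Fin (n c)) (Fin d) ℝ) :
    Matrix (Σ c : Task nu, Fin (n c)) (Σ _ : Task nu, Fin d) ℝ :=
  Matrix.blockDiagonal' X

/-- The total number of tasks. -/
def numTasks (nu : Fin na → ℕ) : ℕ := ∑ i, nu i

/-- The smallest sample size of a task (meaningful if there is a task). -/
def nMin (n : Task nu → ℕ) : ℕ := ⨅ c, n c

/-- `ñ`, the `ℓ₂` norm of the vector of the numbers of users. -/
def nTilde (nu : Fin na → ℕ) : ℝ := √(∑ i, (nu i : ℝ) ^ 2)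

/-- The regularised least squares objective. -/
def objective (X : ∀ c : Task nu, Matrix (Fin (n c)) (Fin d) ℝ)
    (y : ∀ c : Task nu, Fin (n c) → ℝ) (lam1 lam2 lam3 : ℝ) (W : Params d nu) : ℝ :=
  (∑ c, l2 (y c - X c *ᵥ W.weight c) ^ 2)
    + (lam1 * l1 W.θ + lam2 * l12 W.P + lam3 * l12 W.Uᵀ)

/-- `What` minimises the objective over all parameter triples. -/
def IsOptimal (X : ∀ c : Task nu, Matrix (Fin (n c)) (Fin d) ℝ)
    (y : ∀ c : Task nu, Fin (n c) → ℝ) (lam1 lam2 lam3 : ℝ) (What : Params d nu) : Prop :=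
  ∀ W : Params d nu, objective X y lam1 lam2 lam3 What ≤ objective X y lam1 lam2 lam3 W

/-- The responses: true predictor plus noise. -/
def response (X : ∀ c : Task nu, Matrix (Fin (n c)) (Fin d) ℝ) (Wstar : Params d nu)
    (noise : (Σ c : Task nu, Fin (n c)) → ℝ) (c : Task nu) : Fin (n c) → ℝ :=
  fun k => (X c *ᵥ Wstar.weight c) k + noise ⟨c, k⟩

/-- The noise coordinates of all tasks are independent with law `N(0, σ²)`. -/
structure IsGaussianNoise {Ω : Type*} [MeasurableSpace Ω] (μ : Measure Ω)
    (noise : (Σ c : Task nu, Fin (n c)) → Ω → ℝ) (σ : NNReal) : Prop where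
  law : ∀ k, HasLaw (noise k) (gaussianReal 0 (σ ^ 2)) μ
  indep : iIndepFun noise μ

/-! ### The restricted eigenvalue assumption -/

/-- The triples `Γ` satisfying the cone conditions with constants `bθ`, `bp`, `bu` relative to the
zero patterns of `W.θ`, `W.P` (rows) and `W.Uᵀ` (rows). -/
def cone (W : Params d nu) (bθ bp bu : ℝ) : Set (Params d nu) :=
  {Γ | l1 (entries Γ.θ (zeroSet W.θ)) ≤ bθ * l1 (entries Γ.θ (nonzeroSet W.θ)) ∧
    l12 (rows Γ.P (zeroSet W.P)) ≤ bp * l12 (rows Γ.P (nonzeroSet W.P)) ∧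
    l12 (rows Γ.Uᵀ (zeroSet W.Uᵀ)) ≤ bu * l12 (rows Γ.Uᵀ (nonzeroSet W.Uᵀ))}

/-- The quotients `‖X Γ_W̄‖ / (√(n_min n_u) ‖part Γ‖)`, for `Γ` in the cone with
`part Γ ≠ 0`, where `part` gives the norm of one restricted component of `Γ`. -/
def quotients (X : ∀ c : Task nu, Matrix (Fin (n c)) (Fin d) ℝ) (K : Set (Params d nu))
    (part : Params d nu → ℝ) : Set ℝ :=
  {r | ∃ Γ ∈ K, part Γ ≠ 0 ∧
    r = l2 (bigX X *ᵥ Γ.stack) / (√((nMin n : ℝ) * numTasks nu) * part Γ)}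

/-- The restricted eigenvalue assumption: `kθ`, `kp`, `ku` are positive and bound from below all
the quotients of which the restricted eigenvalues are the minima. -/
structure RestrictedEigenvalues (X : ∀ c : Task nu, Matrix (Fin (n c)) (Fin d) ℝ)
    (W : Params d nu) (bθ bp bu kθ kp ku : ℝ) : Prop where
  kθ_pos : 0 < kθ
  kp_pos : 0 < kp
  ku_pos : 0 < ku
  kθ_le : kθ ∈ lowerBounds (quotients X (cone W bθ bp bu)
    fun Γ => l2 (entries Γ.θ (nonzeroSet W.θ)))
  kp_le : kp ∈ lowerBounds (quotients X (cone W bθ bp bu)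
    fun Γ => frob (rows Γ.P (nonzeroSet W.P)))
  ku_le : ku ∈ lowerBounds (quotients X (cone W bθ bp bu)
    fun Γ => frob (rows Γ.Uᵀ (nonzeroSet W.Uᵀ)))

/-! ### Probability level -/

/-- `Z_m(t) = t - m log(1 + t/m)`. -/
def Zfun (m : ℕ) (t : ℝ) : ℝ := t - m * Real.log (1 + t / m)

/-- `1 - exp(-Z/2) / √(2πZ)` with `Z = Z_m(t)`. -/
def level (m : ℕ) (t : ℝ) : ℝ :=
  1 - 1 / √(2 * Real.pi * Zfun m t) * Real.exp (-(Zfun m t / 2))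

/-- `A` has probability at least `p`: for a measurable `A` this says `p ≤ μ A`; in general `A`
contains a measurable event of probability at least `p` (no measurability of the choice of an
optimal solution is needed). -/
def ProbAtLeast {Ω : Type*} [MeasurableSpace Ω] (μ : Measure Ω) (A : Set Ω) (p : ℝ) : Prop :=
  ∃ E : Set Ω, E ⊆ A ∧ MeasurableSet E ∧ p ≤ μ.real E

end MultiTask

end

/-! Write `Γ = What - Wstar`, `D = ‖X Γ.stack‖` and `S = √N`. Comparing the objective at `What` and
at `Wstar` bounds `D²` by twice the correlation of the noise with `X Γ.stack` plus weighted penalty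
differences (`IsOptimal.l2_sq_le`). Each penalty difference is at most the norm of `Γ` on the true
support. By Cauchy–Schwarz and the restricted eigenvalues, their weighted sum is at most `ζ D / S`.
If the correlation term is at most `α D`, then `D² ≤ α D + ζ D / S`.

The term `α` is absorbed by `α S ≤ ζ`, obtained by testing a restricted eigenvalue on a triple with
one moving coordinate: since columns have unit norm, `kθ S ≤ √n_u`, `kp S ≤ √(nu i)` or `ku S ≤ 1`,
according to which true support is nonempty. If all are empty, the cone forces `D = 0`. Hence `D / S
≤ 2 ζ / N`, and the cone conditions pass from the support to the full norms
(`IsOptimal.error_bounds`).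

Only the projection of the noise on the column space of `X` enters the correlation. For `σ > 0` its
squared norm is `σ²` times a `χ²` variable with at most `m = d n_u` degrees of freedom. Polar
coordinates, an integration by parts and Stirling's bound for `Γ(k/2)` control the tail
(`stdGaussian_real_lt_norm_sq_le`). The bound increases with the dimension, and at `m + t` it is at
most `1 - level m t`. -/

namespace MultiTask

/-! ### Stirling's lower bound for the Gamma function -/

/-- Stirling's formula as a quotient: `Γ(x) eˣ x^(1/2 - x)`. -/
noncomputable def gammaRatio (x : ℝ) : ℝ := Real.Gamma x * Real.exp x * x ^ (1 / 2 - x)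

/-- After `Γ(x+1) = x Γ(x)` and logarithms this is `1 ≤ (x + 1/2) log(1 + 1/x)`, which is `log(1 +
y) ≥ 2y/(y + 2)` at `y = 1/x`. -/
theorem gammaRatio_add_one_le {x : ℝ} (hx : 0 < x) : gammaRatio (x + 1) ≤ gammaRatio x := by
  have hx1 : 0 < x + 1 := by linarith
  have hlog : 1 ≤ (x + 1 / 2) * (Real.log (x + 1) - Real.log x) := by
    have h := Real.le_log_one_add_of_nonneg (x := 1 / x) (by positivity)
    have e : 2 * (1 / x) / (1 / x + 2) = 1 / (x + 1 / 2) := by field_simp; ring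
    have e2 : 1 + 1 / x = (x + 1) / x := by field_simp
    rw [e, e2, Real.log_div hx1.ne' hx.ne', div_le_iff₀ (by positivity)] at h
    linarith
  have key : x * Real.exp (x + 1) * (x + 1) ^ (1 / 2 - (x + 1)) ≤
      Real.exp x * x ^ (1 / 2 - x) := by
    rw [Real.rpow_def_of_pos hx1, Real.rpow_def_of_pos hx]
    nth_rewrite 1 [← Real.exp_log hx]
    rw [← Real.exp_add, ← Real.exp_add, ← Real.exp_add, Real.exp_le_exp]
    nlinarith
  unfold gammaRatio
  rw [Real.Gamma_add_one hx.ne']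
  calc x * Real.Gamma x * Real.exp (x + 1) * (x + 1) ^ (1 / 2 - (x + 1))
      = Real.Gamma x * (x * Real.exp (x + 1) * (x + 1) ^ (1 / 2 - (x + 1))) := by ring
    _ ≤ Real.Gamma x * (Real.exp x * x ^ (1 / 2 - x)) :=
        mul_le_mul_of_nonneg_left key (Real.Gamma_pos_of_pos hx).le
    _ = _ := by ring

theorem gammaRatio_add_nat_le {x : ℝ} (hx : 0 < x) (n : ℕ) :
    gammaRatio (x + n) ≤ gammaRatio x := by
  induction n with
  | zero => simp
  | succ n ih =>
    refine le_trans ?_ ih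
    have := gammaRatio_add_one_le (x := x + n) (by positivity)
    rwa [add_assoc, ← Nat.cast_succ] at this

/-- Log-convexity of Gamma, with `N + 1` written as the mean of `N + s` and `N + s + 1` with weights
`s` and `1 - s`. These must be positive, so `s = 0` is separate. -/
theorem factorial_le_Gamma {N : ℕ} (hN : 0 < N) {s : ℝ} (hs : 0 ≤ s) (hs1 : s < 1) :
    (N.factorial : ℝ) ≤ Real.Gamma (N + s) * (N + s) ^ (1 - s) := by
  have hp : (0 : ℝ) < N + s := by positivity
  rcases hs.eq_or_lt with rfl | hs0
  · have := Real.Gamma_nat_eq_factorial N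
    rw [Real.Gamma_add_one (by positivity)] at this
    simp only [add_zero, sub_zero, Real.rpow_one]
    linarith
  have h := Real.Gamma_mul_add_mul_le_rpow_Gamma_mul_rpow_Gamma (s := N + s) (t := N + s + 1)
    (a := s) (b := 1 - s) hp (by positivity) hs0 (by linarith) (by ring)
  have e : s * (N + s) + (1 - s) * (N + s + 1) = (N : ℝ) + 1 := by ring
  have hG := Real.Gamma_pos_of_pos hp
  rw [e, Real.Gamma_nat_eq_factorial, Real.Gamma_add_one hp.ne',
    Real.mul_rpow hp.le hG.le] at h
  have e2 : Real.Gamma (N + s) ^ s * Real.Gamma (N + s) ^ (1 - s) = Real.Gamma (N + s) := by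
    rw [← Real.rpow_add hG]; simp
  calc (N.factorial : ℝ) ≤ _ := h
    _ = (Real.Gamma (N + s) ^ s * Real.Gamma (N + s) ^ (1 - s)) * (N + s) ^ (1 - s) := by ring
    _ = _ := by rw [e2]

/-- Stirling's bound for `N!` transfers to `N + s`; the leftover factor `eˢ / (1 + s/N)^N` is at
least `1`. -/
theorem le_gammaRatio_nat_add {N : ℕ} (hN : 0 < N) {s : ℝ} (hs : 0 ≤ s) (hs1 : s < 1) :
    √(2 * Real.pi) * √(N / (N + s)) ≤ gammaRatio (N + s) := by
  have hN' : (0 : ℝ) < N := by exact_mod_cast hN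
  have hp : (0 : ℝ) < N + s := by positivity
  have h1 := (Stirling.le_factorial_stirling N).trans (factorial_le_Gamma hN hs hs1)
  have h2 : ((N + s) / N : ℝ) ^ N ≤ Real.exp s := by
    have : (N + s) / N ≤ Real.exp (s / N) := by
      have := Real.add_one_le_exp (s / N)
      have e : (N + s) / N = s / N + 1 := by field_simp; ring
      rwa [e]
    calc ((N + s) / N : ℝ) ^ N ≤ Real.exp (s / N) ^ N := by gcongr
      _ = Real.exp s := by rw [← Real.exp_nat_mul]; congr 1; field_simp
  have e1 : √(2 * Real.pi * N) = √(2 * Real.pi) * √N := Real.sqrt_mul (by positivity) _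
  have e2 : √(N / (N + s)) = √N * (N + s) ^ (-(1 / 2) : ℝ) := by
    rw [Real.sqrt_div hN'.le, Real.sqrt_eq_rpow (N + s), Real.rpow_neg hp.le, div_eq_mul_inv]
  have e3 : gammaRatio (N + s) = Real.Gamma (N + s) * (N + s) ^ (1 - s) *
      (Real.exp (N + s) * ((N + s) ^ (-(1 / 2) : ℝ) * ((N + s) ^ N)⁻¹)) := by
    unfold gammaRatio
    have : (N + s) ^ (1 / 2 - (N + s)) =
        (N + s) ^ (1 - s) * ((N + s) ^ (-(1 / 2) : ℝ) * ((N + s) ^ N)⁻¹) := by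
      rw [← Real.rpow_natCast (N + s), ← Real.rpow_neg hp.le, ← Real.rpow_add hp,
        ← Real.rpow_add hp]
      congr 1; ring
    rw [this]; ring
  rw [e3]
  refine le_trans ?_ (mul_le_mul_of_nonneg_right h1 (by positivity))
  rw [e1, e2]
  have e4 : √(2 * Real.pi) * √N * (N / Real.exp 1) ^ N *
      (Real.exp (N + s) * ((N + s) ^ (-(1 / 2) : ℝ) * ((N + s) ^ N)⁻¹)) =
      √(2 * Real.pi) * (√N * (N + s) ^ (-(1 / 2) : ℝ)) *
        (Real.exp s * (((N + s) / N) ^ N)⁻¹) := by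
    have : Real.exp (N + s) = Real.exp 1 ^ N * Real.exp s := by
      rw [← Real.exp_nat_mul, ← Real.exp_add]; simp
    rw [this, div_pow, div_pow]; field_simp
  rw [e4]
  refine le_mul_of_one_le_right (by positivity) ?_
  rw [← div_eq_mul_inv, one_le_div (by positivity)]
  exact h2

/-- Stirling's lower bound for the Gamma function at a positive real argument. -/
theorem sqrt_two_pi_le_gammaRatio {x : ℝ} (hx : 0 < x) : √(2 * Real.pi) ≤ gammaRatio x := by
  -- The ratio does not increase along `x, x + 1, …`, while its lower bound at `n + Int.fract x`
  -- tends to `√(2π)`.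
  have hlim : Filter.Tendsto (fun n : ℕ => √(2 * Real.pi) * √((n : ℝ) / (n + Int.fract x)))
      Filter.atTop (nhds (√(2 * Real.pi) * √1)) := by
    refine Filter.Tendsto.const_mul _ (Filter.Tendsto.sqrt ?_)
    exact tendsto_natCast_div_add_atTop (𝕜 := ℝ) (Int.fract x)
  rw [Real.sqrt_one, mul_one] at hlim
  refine le_of_tendsto hlim ?_
  filter_upwards [Filter.eventually_gt_atTop ⌊x⌋₊] with n hn
  refine (le_gammaRatio_nat_add (by omega) (Int.fract_nonneg x) (Int.fract_lt_one x)).trans ?_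
  have e : (n : ℝ) + Int.fract x = x + (n - ⌊x⌋₊ : ℕ) := by
    rw [Nat.cast_sub hn.le, Int.fract, ← natCast_floor_eq_intCast_floor hx.le]; ring
  rw [e]
  exact gammaRatio_add_nat_le hx _

/-! ### Density and norm tail of the standard Gaussian measure -/

section StdGaussian

variable {E : Type*} [NormedAddCommGroup E] [InnerProductSpace ℝ E] [FiniteDimensional ℝ E]
  [MeasurableSpace E] [BorelSpace E]

/-- The Lebesgue density of the standard Gaussian measure in dimension `k`, as a function of the
norm. -/
noncomputable def radialDensity (k : ℕ) (r : ℝ) : ℝ :=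
  (√(2 * Real.pi) ^ k)⁻¹ * Real.exp (-(r ^ 2 / 2))

theorem radialDensity_pos (k : ℕ) (r : ℝ) : 0 < radialDensity k r := by
  unfold radialDensity
  have := Real.pi_pos
  positivity

theorem continuous_radialDensity (k : ℕ) : Continuous (radialDensity k) := by
  unfold radialDensity; fun_prop

theorem integrable_radialDensity :
    Integrable fun x : E => radialDensity (Module.finrank ℝ E) ‖x‖ := by
  unfold radialDensity
  refine Integrable.const_mul ?_ _
  have h := (GaussianFourier.integrable_cexp_neg_mul_sq_norm_add (V := E) (b := 1 / 2)
    (by norm_num) 0 0).norm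
  refine h.congr (Filter.Eventually.of_forall fun x => ?_)
  simp only [Complex.norm_exp]
  congr 1
  simp [← Complex.ofReal_pow]
  ring

/-- Both measures have the same characteristic function, by the Fourier transform of the Gaussian.
-/
theorem stdGaussian_eq_withDensity :
    stdGaussian E = (volume : Measure E).withDensity
      fun x => ENNReal.ofReal (radialDensity (Module.finrank ℝ E) ‖x‖) := by
  have hint := integrable_radialDensity (E := E)
  have : IsFiniteMeasure ((volume : Measure E).withDensity
      fun x => ENNReal.ofReal (radialDensity (Module.finrank ℝ E) ‖x‖)) :=
    isFiniteMeasure_withDensity_ofReal hint.2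
  apply Measure.ext_of_charFun
  ext t
  rw [charFun_stdGaussian, charFun_apply]
  rw [integral_withDensity_eq_integral_toReal_smul₀ (by
    exact ((continuous_radialDensity _).comp continuous_norm).measurable.ennreal_ofReal.aemeasurable)
    (by simp)]
  have e : ∀ x : E, (ENNReal.ofReal (radialDensity (Module.finrank ℝ E) ‖x‖)).toReal •
      Complex.exp ((inner ℝ x t : ℝ) * Complex.I) =
      ((√(2 * Real.pi) ^ Module.finrank ℝ E : ℝ) : ℂ)⁻¹ *
        Complex.exp (-(1 / 2) * ‖x‖ ^ 2 + Complex.I * (inner ℝ t x : ℝ)) := by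
    intro x
    rw [ENNReal.toReal_ofReal (radialDensity_pos _ _).le, radialDensity, Complex.real_smul,
      Complex.exp_add, real_inner_comm]
    push_cast
    rw [mul_comm Complex.I]
    have : (-(1 / 2) * (‖x‖ : ℂ) ^ 2) = -((‖x‖ : ℂ) ^ 2 / 2) := by ring
    rw [this]; ring
  simp_rw [e]
  rw [integral_const_mul, GaussianFourier.integral_cexp_neg_mul_sq_norm_add (by norm_num)]
  have e2 : ((Real.pi : ℂ) / (1 / 2)) ^ ((Module.finrank ℝ E : ℂ) / 2) =
      ((√(2 * Real.pi) ^ Module.finrank ℝ E : ℝ) : ℂ) := by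
    have h1 : √(2 * Real.pi) ^ Module.finrank ℝ E =
        (2 * Real.pi) ^ ((Module.finrank ℝ E : ℝ) / 2) := by
      rw [Real.sqrt_eq_rpow, ← Real.rpow_natCast, ← Real.rpow_mul (by positivity)]
      congr 1; ring
    rw [h1, Complex.ofReal_cpow (by positivity)]
    push_cast
    congr 1; ring
  have hne : ((√(2 * Real.pi) ^ Module.finrank ℝ E : ℝ) : ℂ) ≠ 0 := by
    have : (√(2 * Real.pi) ^ Module.finrank ℝ E : ℝ) ≠ 0 := by
      have := Real.pi_pos; positivity
    exact_mod_cast this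
  rw [e2, ← mul_assoc, inv_mul_cancel₀ hne, one_mul]
  congr 1
  rw [Complex.I_sq]; ring

/-- The derivative of `-yᵏ exp(-y²/2)` is the integrand times `y² - k`, and this factor is at least
`r² - k` on the ray. -/
theorem setIntegral_Ioi_pow_mul_exp_le {k : ℕ} (hk : 0 < k) {r : ℝ} (hr : 0 ≤ r)
    (hkr : (k : ℝ) < r ^ 2) :
    ∫ y in Set.Ioi r, y ^ (k - 1) * Real.exp (-(y ^ 2 / 2)) ≤
      r ^ k * Real.exp (-(r ^ 2 / 2)) / (r ^ 2 - k) := by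
  have hder : ∀ y ∈ Set.Ici r, HasDerivAt (fun y : ℝ => -(y ^ k * Real.exp (-(y ^ 2 / 2))))
      (y ^ (k - 1) * Real.exp (-(y ^ 2 / 2)) * (y ^ 2 - k)) y := by
    intro y _
    have h1 : HasDerivAt (fun y : ℝ => -(y ^ 2 / 2)) (-y) y := by
      have := ((hasDerivAt_pow 2 y).div_const 2).neg
      convert! this using 1; simp
    have h := ((hasDerivAt_pow k y).mul h1.exp).neg
    convert! h using 1
    obtain ⟨j, rfl⟩ : ∃ j, k = j + 1 := ⟨k - 1, by omega⟩
    simp only [Nat.add_sub_cancel]; ring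
  have hmono : ∀ y ∈ Set.Ioi r, r ^ 2 - k ≤ y ^ 2 - k := by
    intro y hy
    have : r < y := hy
    nlinarith
  have hnn : ∀ y ∈ Set.Ioi r, 0 ≤ y ^ (k - 1) * Real.exp (-(y ^ 2 / 2)) * (y ^ 2 - k) := by
    intro y hy
    have h0 : 0 ≤ y := hr.trans (le_of_lt hy)
    have := hmono y hy
    exact mul_nonneg (by positivity) (by linarith)
  have hlim : Filter.Tendsto (fun y : ℝ => -(y ^ k * Real.exp (-(y ^ 2 / 2)))) Filter.atTop
      (nhds 0) := by
    rw [← neg_zero]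
    refine Filter.Tendsto.neg ?_
    refine squeeze_zero' ?_ ?_ (Real.tendsto_pow_mul_exp_neg_atTop_nhds_zero k)
    · filter_upwards [Filter.eventually_ge_atTop 0] with y hy
      positivity
    -- From `y = 2` on, `y²/2 ≥ y`, so `yᵏ exp(-y)` dominates.
    · filter_upwards [Filter.eventually_ge_atTop 2] with y hy
      have : -(y ^ 2 / 2) ≤ -y := by nlinarith
      gcongr
  have hI := integral_Ioi_of_hasDerivAt_of_nonneg' hder hnn hlim
  have hint := integrableOn_Ioi_deriv_of_nonneg' hder hnn hlim
  rw [le_div_iff₀ (by linarith), ← integral_mul_const]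
  calc ∫ y in Set.Ioi r, y ^ (k - 1) * Real.exp (-(y ^ 2 / 2)) * (r ^ 2 - k)
      ≤ ∫ y in Set.Ioi r, y ^ (k - 1) * Real.exp (-(y ^ 2 / 2)) * (y ^ 2 - k) := by
        refine integral_mono_of_nonneg ?_ hint ?_
        · filter_upwards [ae_restrict_mem measurableSet_Ioi] with y hy
          have h0 : 0 ≤ y := hr.trans (le_of_lt hy)
          exact mul_nonneg (by positivity) (by linarith)
        · filter_upwards [ae_restrict_mem measurableSet_Ioi] with y hy
          have h0 : 0 ≤ y := hr.trans (le_of_lt hy)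
          exact mul_le_mul_of_nonneg_left (hmono y hy) (by positivity)
    _ = _ := by rw [hI]; ring

/-- Polar coordinates; the constant is `k` times the volume of the unit ball times the normalisation
of the density. -/
theorem stdGaussian_real_lt_norm [Nontrivial E] {r : ℝ} (hr : 0 ≤ r) :
    (stdGaussian E).real {x | r < ‖x‖} =
      2 / (√2 ^ Module.finrank ℝ E * Real.Gamma (Module.finrank ℝ E / 2)) *
        ∫ y in Set.Ioi r, y ^ (Module.finrank ℝ E - 1) * Real.exp (-(y ^ 2 / 2)) := by
  set k := Module.finrank ℝ E with hk
  have hkpos : 0 < k := Module.finrank_pos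
  have hmeas : MeasurableSet {x : E | r < ‖x‖} := measurableSet_lt (by fun_prop) (by fun_prop)
  have hball : (volume : Measure E).real (Metric.ball 0 1) =
      √Real.pi ^ k / Real.Gamma (k / 2 + 1) := by
    rw [measureReal_def, InnerProductSpace.volume_ball]
    rw [ENNReal.ofReal_one, one_pow, one_mul, ENNReal.toReal_ofReal]
    have := Real.Gamma_pos_of_pos (show (0 : ℝ) < k / 2 + 1 by positivity)
    positivity
  rw [measureReal_def, stdGaussian_eq_withDensity, withDensity_apply _ hmeas,
    ← ofReal_integral_eq_lintegral_ofReal integrable_radialDensity.integrableOn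
      (Filter.Eventually.of_forall fun x => (radialDensity_pos _ _).le),
    ENNReal.toReal_ofReal (integral_nonneg fun x => (radialDensity_pos _ _).le),
    ← integral_indicator hmeas]
  have e : ∀ x : E, Set.indicator {x : E | r < ‖x‖} (fun x => radialDensity k ‖x‖) x =
      Set.indicator (Set.Ioi r) (radialDensity k) ‖x‖ := by
    intro x
    by_cases h : r < ‖x‖ <;> simp [h]
  simp_rw [← hk, e]
  rw [integral_fun_norm_addHaar (volume : Measure E) (Set.indicator (Set.Ioi r) (radialDensity k)),
    hball, ← hk]
  have e3 : ∀ y : ℝ, y ^ (k - 1) • Set.indicator (Set.Ioi r) (radialDensity k) y =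
      Set.indicator (Set.Ioi r) (fun y => (√(2 * Real.pi) ^ k)⁻¹ *
        (y ^ (k - 1) * Real.exp (-(y ^ 2 / 2)))) y := by
    intro y
    by_cases h : r < y <;> simp [h, radialDensity]
    ring
  simp_rw [e3]
  rw [setIntegral_indicator measurableSet_Ioi,
    Set.inter_eq_self_of_subset_right (Set.Ioi_subset_Ioi hr), integral_const_mul,
    Real.Gamma_add_one (by positivity), Real.sqrt_mul (by norm_num), mul_pow]
  have hG := Real.Gamma_pos_of_pos (show (0 : ℝ) < k / 2 by positivity)
  have := Real.pi_pos
  simp only [nsmul_eq_mul, smul_eq_mul]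
  field_simp

/-- The upper bound for the tail of the `χ²` law with `k` degrees of freedom given by
`stdGaussian_real_lt_norm_sq_le`. -/
noncomputable def chiSqTailBound (k : ℕ) (x : ℝ) : ℝ :=
  √(2 * k) / (√(2 * Real.pi) * (x - k)) * ((x / k) ^ ((k : ℝ) / 2) * Real.exp (-((x - k) / 2)))

/-- An upper bound for the tail of the `χ²` law with `k` degrees of freedom, `k` being the
dimension. -/
theorem stdGaussian_real_lt_norm_sq_le [Nontrivial E] {x : ℝ}
    (hx : (Module.finrank ℝ E : ℝ) < x) :
    (stdGaussian E).real {v | x < ‖v‖ ^ 2} ≤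
      chiSqTailBound (Module.finrank ℝ E) x := by
  unfold chiSqTailBound
  set k := Module.finrank ℝ E with hk
  have hkpos : 0 < k := Module.finrank_pos
  have hk' : (0 : ℝ) < k := by exact_mod_cast hkpos
  have hx0 : 0 < x := hk'.trans hx
  have hset : {v : E | x < ‖v‖ ^ 2} = {v : E | √x < ‖v‖} := by
    ext v; simp [Real.sqrt_lt hx0.le (norm_nonneg v)]
  have hs : √x ^ 2 = x := Real.sq_sqrt hx0.le
  have hGpos := Real.Gamma_pos_of_pos (show (0 : ℝ) < k / 2 by positivity)
  rw [hset, stdGaussian_real_lt_norm (Real.sqrt_nonneg x), ← hk]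
  have hI := setIntegral_Ioi_pow_mul_exp_le hkpos (Real.sqrt_nonneg x) (by rwa [hs])
  rw [hs] at hI
  refine (mul_le_mul_of_nonneg_left hI (by positivity)).trans ?_
  have hS := sqrt_two_pi_le_gammaRatio (show (0 : ℝ) < k / 2 by positivity)
  unfold gammaRatio at hS
  have hG : (Real.Gamma (k / 2))⁻¹ ≤
      Real.exp (k / 2) * (k / 2 : ℝ) ^ (1 / 2 - (k : ℝ) / 2) / √(2 * Real.pi) := by
    have := Real.pi_pos
    rw [inv_eq_one_div, div_le_div_iff₀ hGpos (by positivity)]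
    linarith
  have e1 : √x ^ k = x ^ ((k : ℝ) / 2) := by
    rw [Real.sqrt_eq_rpow, ← Real.rpow_natCast, ← Real.rpow_mul hx0.le]
    congr 1; ring
  have e2 : √2 ^ k = (2 : ℝ) ^ ((k : ℝ) / 2) := by
    rw [Real.sqrt_eq_rpow, ← Real.rpow_natCast, ← Real.rpow_mul (by norm_num)]
    congr 1; ring
  have e3 : (k / 2 : ℝ) ^ (1 / 2 - (k : ℝ) / 2) =
      √(2 * k) / 2 * (2 ^ ((k : ℝ) / 2) / (k : ℝ) ^ ((k : ℝ) / 2)) := by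
    rw [Real.rpow_sub (by positivity), Real.div_rpow hk'.le (by norm_num) ((k : ℝ) / 2),
      ← Real.sqrt_eq_rpow]
    have : √(k / 2 : ℝ) = √(2 * k) / 2 := by
      rw [show (k / 2 : ℝ) = 2 * k / 2 ^ 2 by ring, Real.sqrt_div (by positivity),
        Real.sqrt_sq (by norm_num)]
    rw [this, div_div_eq_mul_div, mul_div_assoc]
  have e4 : Real.exp (-((x - k) / 2)) = Real.exp (k / 2) * Real.exp (-(x / 2)) := by
    rw [← Real.exp_add]; congr 1; ring
  have hxk : 0 < x - k := by linarith
  have hpi := Real.pi_pos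
  calc 2 / (√2 ^ k * Real.Gamma (k / 2)) * (√x ^ k * Real.exp (-(x / 2)) / (x - k))
      = 2 / √2 ^ k * (√x ^ k * Real.exp (-(x / 2)) / (x - k)) * (Real.Gamma (k / 2))⁻¹ := by
        field_simp
    _ ≤ 2 / √2 ^ k * (√x ^ k * Real.exp (-(x / 2)) / (x - k)) *
        (Real.exp (k / 2) * (k / 2 : ℝ) ^ (1 / 2 - (k : ℝ) / 2) / √(2 * Real.pi)) :=
        mul_le_mul_of_nonneg_left hG (by positivity)
    _ = _ := by
        rw [e1, e2, e3, e4, Real.div_rpow hx0.le hk'.le]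
        have := Real.rpow_pos_of_pos (show (0 : ℝ) < 2 by norm_num) ((k : ℝ) / 2)
        field_simp

end StdGaussian

/-! ### Comparing the tail bound with the probability level -/

theorem Zfun_pos {m : ℕ} (hm : 0 < m) {t : ℝ} (ht : 0 < t) : 0 < Zfun m t := by
  have hm' : (0 : ℝ) < m := by exact_mod_cast hm
  have h := Real.log_lt_sub_one_of_pos (x := 1 + t / m) (by positivity)
    (by have : 0 < t / m := by positivity
        linarith)
  have : m * Real.log (1 + t / m) < m * (t / m) := by
    gcongr; linarith
  rw [mul_div_cancel₀ _ hm'.ne'] at this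
  unfold Zfun; linarith

/-- Again `log(1 + y) ≥ 2y/(y + 2)`, at `y = t/m`. This turns the factor `√(2m)/t` of the tail bound
into `1/√Z`. -/
theorem Zfun_le {m : ℕ} (hm : 0 < m) {t : ℝ} (ht : 0 < t) : Zfun m t ≤ t ^ 2 / (2 * m) := by
  have hm' : (0 : ℝ) < m := by exact_mod_cast hm
  have h := Real.le_log_one_add_of_nonneg (x := t / m) (by positivity)
  have h2 : t - t ^ 2 / (2 * m) ≤ m * (2 * (t / m) / (t / m + 2)) := by
    have e : m * (2 * (t / m) / (t / m + 2)) = 2 * t * m / (t + 2 * m) := by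
      field_simp
    rw [e, le_div_iff₀ (by positivity)]
    have e2 : (t - t ^ 2 / (2 * m)) * (t + 2 * m) = 2 * t * m - t ^ 3 / (2 * m) := by
      field_simp; ring
    rw [e2]
    have : 0 ≤ t ^ 3 / (2 * m) := by positivity
    linarith
  have h3 := mul_le_mul_of_nonneg_left h hm'.le
  unfold Zfun; linarith

theorem chiSqTailBound_le_one_sub_level {m : ℕ} (hm : 0 < m) {t : ℝ} (ht : 0 < t) :
    chiSqTailBound m (m + t) ≤ 1 - level m t := by
  have hm' : (0 : ℝ) < m := by exact_mod_cast hm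
  have hZ := Zfun_pos hm ht
  have hpi := Real.pi_pos
  have e1 : ((m + t) / m : ℝ) ^ ((m : ℝ) / 2) * Real.exp (-((m + t - m) / 2)) =
      Real.exp (-(Zfun m t / 2)) := by
    rw [Real.rpow_def_of_pos (by positivity), ← Real.exp_add]
    have : (m + t) / m = 1 + t / m := by field_simp
    rw [this]; unfold Zfun; congr 1; ring
  have e2 : √(2 * m) * √(Zfun m t) ≤ t := by
    rw [← Real.sqrt_mul (by positivity)]
    refine Real.sqrt_le_iff.2 ⟨ht.le, ?_⟩
    have := Zfun_le hm ht
    rw [le_div_iff₀ (by positivity)] at this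
    linarith
  unfold chiSqTailBound level
  rw [e1, sub_sub_cancel]
  refine mul_le_mul_of_nonneg_right ?_ (Real.exp_pos _).le
  rw [Real.sqrt_mul (by positivity) (Zfun m t), add_sub_cancel_left,
    div_le_div_iff₀ (by positivity) (by positivity), one_mul]
  calc √(2 * m) * (√(2 * Real.pi) * √(Zfun m t)) = √(2 * Real.pi) * (√(2 * m) * √(Zfun m t)) := by
        ring
    _ ≤ _ := by gcongr

/-- Needed because the dimension of the column space is only bounded above. The prefactor clearly
grows with `k`; the exponents compare through `k log(m/k) ≤ m - k` and `log m ≤ log x`. -/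
theorem chiSqTailBound_mono {k m : ℕ} (hk : 0 < k) (hkm : k ≤ m) {x : ℝ} (hx : (m : ℝ) < x) :
    chiSqTailBound k x ≤ chiSqTailBound m x := by
  have hk' : (0 : ℝ) < k := by exact_mod_cast hk
  have hkm' : (k : ℝ) ≤ m := by exact_mod_cast hkm
  have hm' : (0 : ℝ) < m := hk'.trans_le hkm'
  have hx0 : 0 < x := hm'.trans hx
  have hxm : 0 < x - m := by linarith
  have hpi := Real.pi_pos
  have hlogx : Real.log m ≤ Real.log x := Real.log_le_log hm' hx.le
  have hlog : k * (Real.log m - Real.log k) ≤ m - k := by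
    have h := Real.log_le_sub_one_of_pos (x := (m : ℝ) / k) (by positivity)
    rw [Real.log_div hm'.ne' hk'.ne'] at h
    have := mul_le_mul_of_nonneg_left h hk'.le
    rwa [mul_sub (k : ℝ) (m / k), mul_div_cancel₀ _ hk'.ne', mul_one] at this
  have hexp : (x / k) ^ ((k : ℝ) / 2) * Real.exp (-((x - k) / 2)) ≤
      (x / m) ^ ((m : ℝ) / 2) * Real.exp (-((x - m) / 2)) := by
    rw [Real.rpow_def_of_pos (by positivity), Real.rpow_def_of_pos (by positivity),
      ← Real.exp_add, ← Real.exp_add, Real.exp_le_exp, Real.log_div hx0.ne' hk'.ne',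
      Real.log_div hx0.ne' hm'.ne']
    nlinarith
  unfold chiSqTailBound
  gcongr

/-! ### Norms -/

section Norms

variable {m k G : Type*} [Fintype m] [Fintype k] [NormedAddCommGroup G]

theorem l2_eq_norm (v : m → ℝ) : l2 v = ‖WithLp.toLp 2 v‖ := by
  simp [l2, EuclideanSpace.norm_eq]

theorem l2_nonneg (v : m → ℝ) : 0 ≤ l2 v := Real.sqrt_nonneg _

theorem frob_nonneg (A : Matrix m k ℝ) : 0 ≤ frob A := Real.sqrt_nonneg _

theorem l2_sq (v : m → ℝ) : l2 v ^ 2 = ∑ i, v i ^ 2 :=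
  Real.sq_sqrt (Finset.sum_nonneg fun _ _ => sq_nonneg _)

theorem l1_entries {m : Type*} (v : m → ℝ) (s : Finset m) : l1 (entries v s) = ∑ i ∈ s, ‖v i‖ := by
  simp only [l1, entries, Real.norm_eq_abs]
  exact Finset.sum_coe_sort s fun i => |v i|

theorem l12_rows {m : Type*} (A : Matrix m k ℝ) (s : Finset m) :
    l12 (rows A s) = ∑ i ∈ s, ‖WithLp.toLp 2 (A i)‖ := by
  rw [← Finset.sum_coe_sort]
  simp only [l12, l2_eq_norm]
  rfl

theorem l2_entries {m : Type*} (v : m → ℝ) (s : Finset m) : l2 (entries v s) = √(∑ i ∈ s, ‖v i‖ ^ 2) := by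
  simp only [l2, entries, Real.norm_eq_abs, sq_abs]
  rw [Finset.sum_coe_sort s fun i => v i ^ 2]

theorem frob_rows {m : Type*} (A : Matrix m k ℝ) (s : Finset m) :
    frob (rows A s) = √(∑ i ∈ s, ‖WithLp.toLp 2 (A i)‖ ^ 2) := by
  rw [← Finset.sum_coe_sort]
  simp only [← l2_eq_norm, l2_sq]
  rfl

theorem sum_norm_le_sqrt_mul {m : Type*} (f : m → G) {s : Finset m} {N : ℕ} (hs : s.card ≤ N) :
    ∑ i ∈ s, ‖f i‖ ≤ √N * √(∑ i ∈ s, ‖f i‖ ^ 2) := by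
  rw [← Real.sqrt_mul (by positivity)]
  refine Real.le_sqrt_of_sq_le ?_
  refine (sq_sum_le_card_mul_sum_sq (s := s) (f := fun i => ‖f i‖)).trans ?_
  have : (s.card : ℝ) ≤ N := by exact_mod_cast hs
  gcongr

theorem l1_eq_sum_norm (v : m → ℝ) : l1 v = ∑ i, ‖v i‖ := rfl

theorem l12_eq_sum_norm (A : Matrix m k ℝ) : l12 A = ∑ i, ‖WithLp.toLp 2 (A i)‖ := by
  simp only [l12, l2_eq_norm]

theorem nonzeroSet_toLp {k : Type*} (A : Matrix m k ℝ) :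
    nonzeroSet (fun i => WithLp.toLp 2 (A i)) = nonzeroSet A := by
  ext i; simp [nonzeroSet]

theorem sum_nonzeroSet_add_sum_zeroSet (a : m → G) (f : m → ℝ) :
    ∑ i ∈ nonzeroSet a, f i + ∑ i ∈ zeroSet a, f i = ∑ i, f i := by
  classical
  have := Finset.sum_filter_add_sum_filter_not Finset.univ (fun i => a i ≠ 0) f
  simp only [not_not] at this
  rw [← this]
  unfold nonzeroSet zeroSet
  congr!

/-- On the support of `a` this is the triangle inequality; off it `b` contributes with a negative
sign. A general normed group covers both entries and rows. -/
theorem sum_norm_sub_sum_norm_le (a b : m → G) :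
    ∑ i, ‖a i‖ - ∑ i, ‖b i‖ ≤ ∑ i ∈ nonzeroSet a, ‖b i - a i‖ := by
  rw [← sum_nonzeroSet_add_sum_zeroSet a fun i => ‖a i‖,
    ← sum_nonzeroSet_add_sum_zeroSet a fun i => ‖b i‖]
  have h0 : ∑ i ∈ zeroSet a, ‖a i‖ = 0 :=
    Finset.sum_eq_zero fun i hi => by simp [zeroSet] at hi; simp [hi]
  have h1 : 0 ≤ ∑ i ∈ zeroSet a, ‖b i‖ := Finset.sum_nonneg fun _ _ => norm_nonneg _
  have h2 : ∑ i ∈ nonzeroSet a, ‖a i‖ ≤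
      ∑ i ∈ nonzeroSet a, ‖b i‖ + ∑ i ∈ nonzeroSet a, ‖b i - a i‖ := by
    rw [← Finset.sum_add_distrib]
    refine Finset.sum_le_sum fun i _ => ?_
    have := norm_sub_norm_le (a i) (b i)
    rw [norm_sub_rev] at this
    linarith
  linarith

end Norms

/-! ### Algebra of the model -/

variable {d na : ℕ} {nu : Fin na → ℕ} {n : Task nu → ℕ}

theorem bigX_mulVec_apply (X : ∀ c : Task nu, Matrix (Fin (n c)) (Fin d) ℝ) (W : Params d nu)
    (c : Task nu) (k : Fin (n c)) : (bigX X *ᵥ W.stack) ⟨c, k⟩ = (X c *ᵥ W.weight c) k := by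
  unfold bigX mulVec dotProduct Params.stack
  refine (Fintype.sum_sigma _).trans ?_
  rw [Finset.sum_eq_single c]
  · simp [blockDiagonal'_apply_eq]
  · intro b _ hb
    exact Finset.sum_eq_zero fun l _ => 
      mul_eq_zero_of_left (blockDiagonal'_apply_ne X k l hb.symm) _
  · simp

theorem Params.stack_sub (V W : Params d nu) : (V - W).stack = V.stack - W.stack := by
  ext k
  change (V.θ _ - W.θ _) + (V.P _ _ - W.P _ _) + (V.U _ _ - W.U _ _) =
    (V.θ _ + V.P _ _ + V.U _ _) - (W.θ _ + W.P _ _ + W.U _ _)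
  ring

theorem sum_l2_response_sub_sq (X : ∀ c : Task nu, Matrix (Fin (n c)) (Fin d) ℝ)
    (Wstar W : Params d nu) (e : (Σ c : Task nu, Fin (n c)) → ℝ) :
    ∑ c, l2 (response X Wstar e c - X c *ᵥ W.weight c) ^ 2 =
      ∑ k, (e k - (bigX X *ᵥ (W - Wstar).stack) k) ^ 2 := by
  refine Eq.trans ?_ (Fintype.sum_sigma _).symm
  refine Finset.sum_congr rfl fun c _ => ?_
  rw [l2_sq]
  refine Finset.sum_congr rfl fun k _ => ?_
  rw [Params.stack_sub, mulVec_sub, Pi.sub_apply, Pi.sub_apply, bigX_mulVec_apply,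
    bigX_mulVec_apply, response]
  ring

/-- The basic inequality for an optimal solution. -/
theorem IsOptimal.l2_sq_le {X : ∀ c : Task nu, Matrix (Fin (n c)) (Fin d) ℝ}
    {Wstar What : Params d nu} {e : (Σ c : Task nu, Fin (n c)) → ℝ} {lam1 lam2 lam3 : ℝ}
    (h : IsOptimal X (response X Wstar e) lam1 lam2 lam3 What) :
    l2 (bigX X *ᵥ (What - Wstar).stack) ^ 2 ≤
      2 * (e ⬝ᵥ (bigX X *ᵥ (What - Wstar).stack)) + lam1 * (l1 Wstar.θ - l1 What.θ) +
        lam2 * (l12 Wstar.P - l12 What.P) + lam3 * (l12 Wstar.Uᵀ - l12 What.Uᵀ) := by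
  have h := h Wstar
  unfold objective at h
  rw [sum_l2_response_sub_sq, sum_l2_response_sub_sq, Params.stack_sub Wstar, sub_self,
    mulVec_zero] at h
  rw [l2_sq]
  have e1 : ∑ k, (e k - (bigX X *ᵥ (What - Wstar).stack) k) ^ 2 =
      ∑ k, e k ^ 2 - 2 * (e ⬝ᵥ (bigX X *ᵥ (What - Wstar).stack)) +
        ∑ k, (bigX X *ᵥ (What - Wstar).stack) k ^ 2 := by
    rw [dotProduct, Finset.mul_sum, ← Finset.sum_sub_distrib, ← Finset.sum_add_distrib]
    exact Finset.sum_congr rfl fun k _ => by ring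
  rw [e1] at h
  simp only [Pi.zero_apply, sub_zero] at h
  linarith

/-- A parameter triple moving only the coefficient of one feature. -/
theorem l2_bigX_mulVec_of_weight_eq {X : ∀ c : Task nu, Matrix (Fin (n c)) (Fin d) ℝ}
    (hX : ∀ c l, ∑ k, X c k l ^ 2 = 1) {Γ : Params d nu} {l : Fin d} {w : Task nu → ℝ}
    (hΓ : ∀ c, Γ.weight c = Pi.single l (w c)) :
    l2 (bigX X *ᵥ Γ.stack) = √(∑ c, w c ^ 2) := by
  unfold l2
  rw [Fintype.sum_sigma]
  congr 1
  refine Finset.sum_congr rfl fun c _ => ?_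
  have h : ∀ k, (X c *ᵥ Pi.single l (w c)) k = X c k l * w c := fun k => by
    simp [mulVec, dotProduct, Pi.single_apply]
  simp_rw [bigX_mulVec_apply, hΓ, h, mul_pow]
  rw [← Finset.sum_mul, hX, one_mul]

/-- A column without entries cannot have norm `1`. -/
theorem nMin_pos (hd : 0 < d) {X : ∀ c : Task nu, Matrix (Fin (n c)) (Fin d) ℝ}
    (hX : ∀ c l, ∑ k, X c k l ^ 2 = 1) [Nonempty (Task nu)] : 0 < nMin n := by
  obtain ⟨c, hc⟩ := ciInf_mem n
  unfold nMin
  rw [← hc]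
  by_contra! h
  have h0 : n c = 0 := by omega
  have : IsEmpty (Fin (n c)) := by rw [h0]; infer_instance
  simpa using hX c ⟨0, hd⟩

theorem card_task (nu : Fin na → ℕ) : Fintype.card (Task nu) = numTasks nu := by
  simp [numTasks, Fintype.card_sigma]

/-! ### Restricted eigenvalues -/

/-- Clearing the denominator also covers the triples with `part Γ = 0`, which have no quotient. -/
theorem mul_le_of_mem_lowerBounds {X : ∀ c : Task nu, Matrix (Fin (n c)) (Fin d) ℝ}
    {K : Set (Params d nu)} {part : Params d nu → ℝ} (hpart : ∀ Γ, 0 ≤ part Γ) {κ : ℝ}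
    (hκ : κ ∈ lowerBounds (quotients X K part)) (hN : 0 < (nMin n : ℝ) * numTasks nu)
    {Γ : Params d nu} (hΓ : Γ ∈ K) :
    κ * √((nMin n : ℝ) * numTasks nu) * part Γ ≤ l2 (bigX X *ᵥ Γ.stack) := by
  rcases (hpart Γ).eq_or_lt with h | h
  · rw [← h, mul_zero]; exact l2_nonneg _
  · have := hκ ⟨Γ, hΓ, h.ne', rfl⟩
    rw [le_div_iff₀ (by positivity)] at this
    linarith

theorem mem_cone_of_eq_zero {W Γ : Params d nu} {bθ bp bu : ℝ} (hbθ : 0 < bθ) (hbp : 0 < bp)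
    (hbu : 0 < bu) (hθ : ∀ l ∈ zeroSet W.θ, Γ.θ l = 0) (hP : ∀ l ∈ zeroSet W.P, Γ.P l = 0)
    (hU : ∀ c ∈ zeroSet W.Uᵀ, Γ.Uᵀ c = 0) : Γ ∈ cone W bθ bp bu := by
  simp only [cone, Set.mem_ofPred_eq, l1_entries, l12_rows]
  refine ⟨?_, ?_, ?_⟩
  · rw [Finset.sum_eq_zero fun l hl => by rw [hθ l hl, norm_zero]]; positivity
  · rw [Finset.sum_eq_zero fun l hl => by rw [hP l hl, WithLp.toLp_zero, norm_zero]]; positivity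
  · rw [Finset.sum_eq_zero fun l hl => by rw [hU l hl, WithLp.toLp_zero, norm_zero]]; positivity

variable {X : ∀ c : Task nu, Matrix (Fin (n c)) (Fin d) ℝ} {W : Params d nu}
  {bθ bp bu kθ kp ku : ℝ}

/-- Test triple: a unit vector in `θ` at a support coordinate, so that every task contributes one
unit column. -/
theorem RestrictedEigenvalues.kθ_mul_le (hk : RestrictedEigenvalues X W bθ bp bu kθ kp ku)
    (hX : ∀ c l, ∑ k, X c k l ^ 2 = 1) (hbθ : 0 < bθ) (hbp : 0 < bp) (hbu : 0 < bu)
    (hN : 0 < (nMin n : ℝ) * numTasks nu) {l : Fin d} (hl : l ∈ nonzeroSet W.θ) :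
    kθ * √((nMin n : ℝ) * numTasks nu) ≤ √(numTasks nu) := by
  set Γ : Params d nu := ⟨Pi.single l 1, 0, 0⟩
  have hΓ : Γ ∈ cone W bθ bp bu := by
    refine mem_cone_of_eq_zero hbθ hbp hbu (fun l' hl' => ?_) (fun _ _ => rfl) fun _ _ => rfl
    refine Pi.single_eq_of_ne (fun h => ?_) _
    subst h
    simp [nonzeroSet, zeroSet] at hl hl'
    exact hl hl'
  have h := mul_le_of_mem_lowerBounds (fun Γ => l2_nonneg _) hk.kθ_le hN hΓ
  rw [l2_bigX_mulVec_of_weight_eq (l := l) (w := fun _ => 1) hX (fun c => by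
    ext l'; simp [Params.weight, Γ])] at h
  have hp : l2 (entries Γ.θ (nonzeroSet W.θ)) = 1 := by
    rw [l2_entries, Finset.sum_eq_single_of_mem l hl fun l' _ h => by simp [Γ, h]]
    simp [Γ]
  rw [hp] at h
  simpa [← card_task] using h

/-- Test triple: a single entry of `P`, in a support row and column `i`; only the `nu i` tasks of
attribute `i` contribute. -/
theorem RestrictedEigenvalues.kp_mul_le (hk : RestrictedEigenvalues X W bθ bp bu kθ kp ku)
    (hX : ∀ c l, ∑ k, X c k l ^ 2 = 1) (hbθ : 0 < bθ) (hbp : 0 < bp) (hbu : 0 < bu)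
    (hN : 0 < (nMin n : ℝ) * numTasks nu) (i : Fin na) {l : Fin d} (hl : l ∈ nonzeroSet W.P) :
    kp * √((nMin n : ℝ) * numTasks nu) ≤ √(nu i) := by
  set Γ : Params d nu := ⟨0, Matrix.of fun l' => if l' = l then Pi.single i 1 else 0, 0⟩
  have hΓ : Γ ∈ cone W bθ bp bu := by
    refine mem_cone_of_eq_zero hbθ hbp hbu (fun _ _ => rfl) (fun l' hl' => ?_) fun _ _ => rfl
    refine if_neg fun h => ?_
    subst h
    simp [nonzeroSet, zeroSet] at hl hl'
    exact hl hl'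
  have hrow : ∀ l', Γ.P l' = if l' = l then Pi.single i 1 else 0 := fun _ => rfl
  have h := mul_le_of_mem_lowerBounds (fun Γ => frob_nonneg _) hk.kp_le hN hΓ
  rw [l2_bigX_mulVec_of_weight_eq (l := l) (w := fun c => if c.1 = i then 1 else 0) hX (fun c => by
    ext l'
    by_cases h1 : l' = l <;> by_cases h2 : c.1 = i <;>
      simp [Params.weight, Γ, h1, h2])] at h
  have hp : frob (rows Γ.P (nonzeroSet W.P)) = 1 := by
    rw [frob_rows, Finset.sum_eq_single_of_mem l hl fun l' _ h => by simp [hrow, h]]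
    simp [hrow]
  change kp * _ * frob (rows Γ.P (nonzeroSet W.P)) ≤ _ at h
  rw [hp] at h
  have hc : ∑ c : Task nu, (if c.1 = i then 1 else 0 : ℝ) ^ 2 = nu i := by
    rw [Fintype.sum_sigma, Finset.sum_eq_single i]
    · simp
    · intro j _ hj; simp [hj]
    · simp
  rwa [hc, mul_one] at h

/-- Test triple: a single entry of `U`, moving one unit column of one task. -/
theorem RestrictedEigenvalues.ku_mul_le (hk : RestrictedEigenvalues X W bθ bp bu kθ kp ku)
    (hX : ∀ c l, ∑ k, X c k l ^ 2 = 1) (hbθ : 0 < bθ) (hbp : 0 < bp) (hbu : 0 < bu)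
    (hN : 0 < (nMin n : ℝ) * numTasks nu) (l : Fin d) {c : Task nu}
    (hc : c ∈ nonzeroSet W.Uᵀ) :
    ku * √((nMin n : ℝ) * numTasks nu) ≤ 1 := by
  set Γ : Params d nu := ⟨0, 0, Matrix.of fun l' c' => if c' = c then (Pi.single l 1 : Fin d → ℝ) l' else 0⟩
  have hrow : ∀ c', Γ.Uᵀ c' = if c' = c then Pi.single l 1 else 0 := by
    intro c'; ext l'; by_cases h : c' = c <;> simp [Γ, h]
  have hΓ : Γ ∈ cone W bθ bp bu := by
    refine mem_cone_of_eq_zero hbθ hbp hbu (fun _ _ => rfl) (fun _ _ => rfl) fun c' hc' => ?_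
    rw [hrow]
    refine if_neg fun h => ?_
    subst h
    simp [nonzeroSet, zeroSet] at hc hc'
    exact hc hc'
  have h := mul_le_of_mem_lowerBounds (fun Γ => frob_nonneg _) hk.ku_le hN hΓ
  rw [l2_bigX_mulVec_of_weight_eq (l := l) (w := fun c' => if c' = c then 1 else 0) hX
    (fun c' => by
      ext l'
      by_cases h1 : l' = l <;> by_cases h2 : c' = c <;>
        simp [Params.weight, Γ, h1, h2, Pi.single_apply])] at h
  have hp : frob (rows Γ.Uᵀ (nonzeroSet W.Uᵀ)) = 1 := by
    rw [frob_rows, Finset.sum_eq_single_of_mem c hc fun c' _ h => by simp [hrow, h]]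
    simp [hrow]
  change ku * _ * frob (rows Γ.Uᵀ (nonzeroSet W.Uᵀ)) ≤ _ at h
  rw [hp] at h
  simpa using h

theorem Params.stack_eq_zero {Γ : Params d nu} (hθ : l1 Γ.θ = 0) (hP : l12 Γ.P = 0)
    (hU : l12 Γ.Uᵀ = 0) : Γ.stack = 0 := by
  rw [l1_eq_sum_norm, Finset.sum_eq_zero_iff_of_nonneg fun _ _ => norm_nonneg _] at hθ
  rw [l12_eq_sum_norm, Finset.sum_eq_zero_iff_of_nonneg fun _ _ => norm_nonneg _] at hP hU
  ext ⟨c, l⟩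
  have h1 : Γ.θ l = 0 := by simpa using hθ l (Finset.mem_univ l)
  have h2 : Γ.P l = 0 := by simpa using hP l (Finset.mem_univ l)
  have h3 : Γ.Uᵀ c = 0 := by simpa using hU c (Finset.mem_univ c)
  have h3' : Γ.U l c = 0 := congrFun h3 l
  simp [Params.stack, Params.weight, h1, h2, h3']

/-! ### Deterministic error bounds -/

theorem l1_le_of_cone {v a : Fin d → ℝ} {b : ℝ}
    (h : l1 (entries v (zeroSet a)) ≤ b * l1 (entries v (nonzeroSet a))) :
    l1 v ≤ (b + 1) * l1 (entries v (nonzeroSet a)) := by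
  rw [l1_eq_sum_norm, ← sum_nonzeroSet_add_sum_zeroSet a, ← l1_entries, ← l1_entries]
  linarith

theorem l12_le_of_cone {m k : Type*} [Fintype m] [Fintype k] {A B : Matrix m k ℝ} {b : ℝ}
    (h : l12 (rows A (zeroSet B)) ≤ b * l12 (rows A (nonzeroSet B))) :
    l12 A ≤ (b + 1) * l12 (rows A (nonzeroSet B)) := by
  rw [l12_eq_sum_norm, ← sum_nonzeroSet_add_sum_zeroSet B, ← l12_rows, ← l12_rows]
  linarith

theorem l1_sub_l1_le (a b : Fin d → ℝ) :
    l1 a - l1 b ≤ l1 (entries (b - a) (nonzeroSet a)) := by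
  rw [l1_entries]
  exact sum_norm_sub_sum_norm_le a b

theorem l12_sub_l12_le {m k : Type*} [Fintype m] [Fintype k] (A B : Matrix m k ℝ) :
    l12 A - l12 B ≤ l12 (rows (B - A) (nonzeroSet A)) := by
  rw [l12_rows, l12_eq_sum_norm, l12_eq_sum_norm, ← nonzeroSet_toLp]
  exact sum_norm_sub_sum_norm_le (fun i => WithLp.toLp 2 (A i)) fun i => WithLp.toLp 2 (B i)

theorem l1_entries_le (v : Fin d → ℝ) {s : Finset (Fin d)} {N : ℕ} (hs : s.card ≤ N) :
    l1 (entries v s) ≤ √N * l2 (entries v s) := by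
  rw [l1_entries, l2_entries]
  exact sum_norm_le_sqrt_mul v hs

theorem l12_rows_le {m k : Type*} [Fintype m] [Fintype k] (A : Matrix m k ℝ) {s : Finset m}
    {N : ℕ} (hs : s.card ≤ N) : l12 (rows A s) ≤ √N * frob (rows A s) := by
  rw [l12_rows, frob_rows]
  exact sum_norm_le_sqrt_mul (fun i => WithLp.toLp 2 (A i)) hs

theorem sqrt_natCast_le_self (k : ℕ) : √(k : ℝ) ≤ k := by
  rcases Nat.eq_zero_or_pos k with rfl | hk
  · simp
  have : (1 : ℝ) ≤ k := by exact_mod_cast hk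
  exact Real.sqrt_le_iff.2 ⟨by positivity, by nlinarith⟩

theorem sqrt_le_nTilde (i : Fin na) : √(nu i : ℝ) ≤ nTilde nu := by
  refine (sqrt_natCast_le_self _).trans (Real.le_sqrt_of_sq_le ?_)
  exact Finset.single_le_sum (f := fun i => (nu i : ℝ) ^ 2) (fun _ _ => sq_nonneg _)
    (Finset.mem_univ i)

theorem one_le_sqrt_natCast {ι : Type*} {s : Finset ι} {i : ι} (hi : i ∈ s) {N : ℕ} (hs : s.card ≤ N) :
    1 ≤ √(N : ℝ) := by
  have : 1 ≤ N := (Finset.card_pos.2 ⟨i, hi⟩).trans_le hs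
  exact Real.one_le_sqrt.2 (by exact_mod_cast this)

/-- One summand of `ζ` already dominates `α S`; `r` will be `n_u`, `ñ` or `1`. -/
theorem mul_le_mul_sqrt_div {lam α S κ q : ℝ} (hκ : 0 < κ) (hα : 0 ≤ α) (hq : 1 ≤ q) {r : ℝ}
    (hκS : κ * S ≤ r) (hlam : r * α ≤ lam) (hlam0 : 0 ≤ lam) : α * S ≤ lam * q / κ := by
  rw [le_div_iff₀ hκ]
  have := mul_le_mul_of_nonneg_right hκS hα
  have := le_mul_of_one_le_right hlam0 hq
  linarith

/-- The deterministic error bounds, valid as soon as the noise `e` correlates with each vector of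
the column space of the design at most as strongly as `α / 2` times its norm. -/
theorem IsOptimal.error_bounds (hd : 0 < d) (hna : 0 < na)
    (hX : ∀ c l, ∑ k, X c k l ^ 2 = 1) (hN0 : 0 < (nMin n : ℝ) * numTasks nu)
    {Wstar What : Params d nu} {e : (Σ c : Task nu, Fin (n c)) → ℝ} {α lam1 lam2 lam3 : ℝ}
    (hα : 0 ≤ α)
    (he : ∀ Γ : Params d nu, 2 * (e ⬝ᵥ (bigX X *ᵥ Γ.stack)) ≤ α * l2 (bigX X *ᵥ Γ.stack))
    (hlam1 : numTasks nu * α ≤ lam1) (hlam2 : nTilde nu * α ≤ lam2) (hlam3 : α ≤ lam3)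
    {nθ np nua : ℕ} (hnθ : (nonzeroSet Wstar.θ).card ≤ nθ) (hnp : (nonzeroSet Wstar.P).card ≤ np)
    (hnua : (nonzeroSet Wstar.Uᵀ).card ≤ nua) (hbθ : 0 < bθ) (hbp : 0 < bp) (hbu : 0 < bu)
    (hk : RestrictedEigenvalues X Wstar bθ bp bu kθ kp ku)
    (hopt : IsOptimal X (response X Wstar e) lam1 lam2 lam3 What)
    (hcone : What - Wstar ∈ cone Wstar bθ bp bu)
    {ζ : ℝ} (hζ : ζ = lam1 * √nθ / kθ + lam2 * √np / kp + lam3 * √nua / ku)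
    {N : ℝ} (hN : N = nMin n * numTasks nu) :
    1 / N * l2 (bigX X *ᵥ What.stack - bigX X *ᵥ Wstar.stack) ^ 2 ≤ (2 * ζ / N) ^ 2 ∧
    l1 (What.θ - Wstar.θ) ≤ 2 * (bθ + 1) * √nθ / (kθ * N) * ζ ∧
    l12 (What.P - Wstar.P) ≤ 2 * (bp + 1) * √np / (kp * N) * ζ ∧
    l12 (What.Uᵀ - Wstar.Uᵀ) ≤ 2 * (bu + 1) * √nua / (ku * N) * ζ := by
  rw [← mulVec_sub, ← Params.stack_sub]
  have hbasic := hopt.l2_sq_le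
  have hcorr := he (What - Wstar)
  have hR1 := mul_le_of_mem_lowerBounds (fun Γ => l2_nonneg _) hk.kθ_le hN0 hcone
  have hR2 := mul_le_of_mem_lowerBounds (fun Γ => frob_nonneg _) hk.kp_le hN0 hcone
  have hR3 := mul_le_of_mem_lowerBounds (fun Γ => frob_nonneg _) hk.ku_le hN0 hcone
  have hT1 := fun l (hl : l ∈ nonzeroSet Wstar.θ) => hk.kθ_mul_le hX hbθ hbp hbu hN0 hl
  have hT2 := fun l (hl : l ∈ nonzeroSet Wstar.P) =>
    hk.kp_mul_le hX hbθ hbp hbu hN0 ⟨0, hna⟩ hl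
  have hT3 := fun c (hc : c ∈ nonzeroSet Wstar.Uᵀ) =>
    hk.ku_mul_le hX hbθ hbp hbu hN0 ⟨0, hd⟩ hc
  rw [← hN] at hR1 hR2 hR3 hT1 hT2 hT3 hN0
  obtain ⟨hC1, hC2, hC3⟩ := hcone
  have hD1 := l1_sub_l1_le Wstar.θ What.θ
  have hD2 := l12_sub_l12_le Wstar.P What.P
  have hD3 := l12_sub_l12_le Wstar.Uᵀ What.Uᵀ
  have hκ1 := hk.kθ_pos
  have hκ2 := hk.kp_pos
  have hκ3 := hk.ku_pos
  have hlam1' : 0 ≤ lam1 := le_trans (by positivity) hlam1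
  have hlam2' : 0 ≤ lam2 := le_trans (mul_nonneg (Real.sqrt_nonneg _) hα) hlam2
  have hlam3' : 0 ≤ lam3 := hα.trans hlam3
  have hF1 := l1_le_of_cone hC1
  have hF2 := l12_le_of_cone hC2
  have hF3 := l12_le_of_cone hC3
  have hG1 := l1_entries_le (What - Wstar).θ hnθ
  have hG2 := l12_rows_le (What - Wstar).P hnp
  have hG3 := l12_rows_le (What - Wstar).Uᵀ hnua
  change l1 Wstar.θ - l1 What.θ ≤ l1 (entries (What - Wstar).θ _) at hD1
  change l12 Wstar.P - l12 What.P ≤ l12 (rows (What - Wstar).P _) at hD2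
  change l12 Wstar.Uᵀ - l12 What.Uᵀ ≤ l12 (rows (What - Wstar).Uᵀ _) at hD3
  change _ ∧ l1 (What - Wstar).θ ≤ _ ∧ l12 (What - Wstar).P ≤ _ ∧ l12 (What - Wstar).Uᵀ ≤ _
  -- When the error vanishes on the true supports, the cone conditions make it vanish everywhere.
  have hzero : l1 (entries (What - Wstar).θ (nonzeroSet Wstar.θ)) = 0 →
      l12 (rows (What - Wstar).P (nonzeroSet Wstar.P)) = 0 →
      l12 (rows (What - Wstar).Uᵀ (nonzeroSet Wstar.Uᵀ)) = 0 →
      l2 (bigX X *ᵥ (What - Wstar).stack) = 0 := by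
    intro h1 h2 h3
    rw [h1, mul_zero] at hF1
    rw [h2, mul_zero] at hF2
    rw [h3, mul_zero] at hF3
    have hs := Params.stack_eq_zero (Γ := What - Wstar)
      (hF1.antisymm (Finset.sum_nonneg fun _ _ => abs_nonneg _))
      (hF2.antisymm (Finset.sum_nonneg fun _ _ => l2_nonneg _))
      (hF3.antisymm (Finset.sum_nonneg fun _ _ => l2_nonneg _))
    rw [hs, mulVec_zero]
    simp [l2]
  set D := l2 (bigX X *ᵥ (What - Wstar).stack)
  set a1 := l1 (entries (What - Wstar).θ (nonzeroSet Wstar.θ)) with ha1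
  set a2 := l12 (rows (What - Wstar).P (nonzeroSet Wstar.P)) with ha2
  set a3 := l12 (rows (What - Wstar).Uᵀ (nonzeroSet Wstar.Uᵀ)) with ha3
  have hDnn : 0 ≤ D := l2_nonneg _
  have hS : 0 < √N := Real.sqrt_pos.2 hN0
  have hSS : √N * √N = N := Real.mul_self_sqrt hN0.le
  set S := √N
  have bound : ∀ {κ a f q : ℝ}, 0 < κ → 0 ≤ q → κ * S * f ≤ D → a ≤ q * f →
      a ≤ q / κ * (D / S) := by
    intro κ a f q hκ hq h1 h2
    have : f ≤ D / (κ * S) := by rw [le_div_iff₀ (by positivity)]; linarith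
    calc a ≤ q * f := h2
      _ ≤ q * (D / (κ * S)) := by gcongr
      _ = _ := by field_simp
  have hA1 : a1 ≤ √nθ / kθ * (D / S) := bound hκ1 (Real.sqrt_nonneg _) hR1 hG1
  have hA2 : a2 ≤ √np / kp * (D / S) := bound hκ2 (Real.sqrt_nonneg _) hR2 hG2
  have hA3 : a3 ≤ √nua / ku * (D / S) := bound hκ3 (Real.sqrt_nonneg _) hR3 hG3
  have hz1 : 0 ≤ lam1 * √nθ / kθ := by positivity
  have hz2 : 0 ≤ lam2 * √np / kp := by positivity
  have hz3 : 0 ≤ lam3 * √nua / ku := by positivity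
  have hζ0 : 0 ≤ ζ := by rw [hζ]; positivity
  have hquad : D ^ 2 ≤ α * D + ζ * (D / S) := by
    have i1 := mul_le_mul_of_nonneg_left (hD1.trans hA1) hlam1'
    have i2 := mul_le_mul_of_nonneg_left (hD2.trans hA2) hlam2'
    have i3 := mul_le_mul_of_nonneg_left (hD3.trans hA3) hlam3'
    have e : ζ * (D / S) = lam1 * (√nθ / kθ * (D / S)) + lam2 * (√np / kp * (D / S)) +
        lam3 * (√nua / ku * (D / S)) := by rw [hζ]; ring
    rw [e]; linarith
  -- A nonempty support supplies a test triple and makes its sparsity bound at least `1`; with no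
  -- support at all, `hzero` applies.
  have hαζ : α * S ≤ ζ ∨ D = 0 := by
    rcases (nonzeroSet Wstar.θ).eq_empty_or_nonempty with h1 | ⟨l, hl⟩
    swap
    · left
      have := mul_le_mul_sqrt_div hκ1 hα (one_le_sqrt_natCast hl hnθ)
        ((hT1 l hl).trans (sqrt_natCast_le_self _)) hlam1 hlam1'
      linarith
    rcases (nonzeroSet Wstar.P).eq_empty_or_nonempty with h2 | ⟨l, hl⟩
    swap
    · left
      have := mul_le_mul_sqrt_div hκ2 hα (one_le_sqrt_natCast hl hnp)
        ((hT2 l hl).trans (sqrt_le_nTilde _)) hlam2 hlam2'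
      linarith
    rcases (nonzeroSet Wstar.Uᵀ).eq_empty_or_nonempty with h3 | ⟨c, hc⟩
    swap
    · left
      have := mul_le_mul_sqrt_div hκ3 hα (one_le_sqrt_natCast hc hnua) (hT3 c hc)
        (by rwa [one_mul]) hlam3'
      linarith
    right
    refine hzero ?_ ?_ ?_
    · rw [ha1, l1_entries, h1, Finset.sum_empty]
    · rw [ha2, l12_rows, h2, Finset.sum_empty]
    · rw [ha3, l12_rows, h3, Finset.sum_empty]
  have hDle : D / S ≤ 2 * ζ / N := by
    rcases hDnn.eq_or_lt with h0 | hpos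
    · rw [← h0, zero_div]; positivity
    have hα' := hαζ.resolve_right hpos.ne'
    have h1 : D ≤ α + ζ / S := by
      refine le_of_mul_le_mul_right ?_ hpos
      have e : (α + ζ / S) * D = α * D + ζ * (D / S) := by ring
      rw [e, ← sq]; exact hquad
    have h2 : α ≤ ζ / S := by rwa [le_div_iff₀ hS]
    rw [div_le_iff₀ hS, ← hSS]
    calc D ≤ 2 * (ζ / S) := by linarith
      _ = _ := by field_simp
  have final : ∀ {b κ q a x : ℝ}, 0 < b → 0 < κ → 0 ≤ q → x ≤ (b + 1) * a →
      a ≤ q / κ * (D / S) → x ≤ 2 * (b + 1) * q / (κ * N) * ζ := by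
    intro b κ q a x hb hκ hq h1 h2
    calc x ≤ (b + 1) * a := h1
      _ ≤ (b + 1) * (q / κ * (D / S)) := by gcongr
      _ ≤ (b + 1) * (q / κ * (2 * ζ / N)) := by gcongr
      _ = _ := by field_simp
  refine ⟨?_, final hbθ hκ1 (Real.sqrt_nonneg _) hF1 hA1,
    final hbp hκ2 (Real.sqrt_nonneg _) hF2 hA2, final hbu hκ3 (Real.sqrt_nonneg _) hF3 hA3⟩
  calc 1 / N * D ^ 2 = (D / S) ^ 2 := by rw [div_pow, sq S, hSS]; ring
    _ ≤ _ := by gcongr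

/-! ### Projections of Gaussian noise -/

/-- For `v` in `V`, pairing with the projection of `x` equals pairing with `x`, so the
characteristic functions agree. -/
theorem stdGaussian_map_orthogonalProjectionOnto {E : Type*} [NormedAddCommGroup E]
    [InnerProductSpace ℝ E] [FiniteDimensional ℝ E] [MeasurableSpace E] [BorelSpace E]
    (V : Submodule ℝ E) :
    (stdGaussian E).map V.orthogonalProjectionOnto = stdGaussian V := by
  have : IsProbabilityMeasure ((stdGaussian E).map V.orthogonalProjectionOnto) :=
    Measure.isProbabilityMeasure_map (by fun_prop)
  apply Measure.ext_of_charFun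
  ext v
  rw [charFun_stdGaussian, charFun_apply, integral_map (by fun_prop) (by fun_prop)]
  have e : ∀ x : E, inner ℝ (V.orthogonalProjectionOnto x) v = inner ℝ x (v : E) := fun x => by
    rw [Submodule.inner_orthogonalProjectionOnto_eq_of_mem_right]
  simp_rw [e]
  rw [← charFun_apply, charFun_stdGaussian, Submodule.coe_norm]

/-- Independent centred Gaussian variables, rescaled to variance one, form a standard Gaussian
vector. -/
theorem map_toLp_div_eq_stdGaussian {κ Ω : Type*} [Fintype κ] [MeasurableSpace Ω] {μ : Measure Ω}
    {σ : NNReal} (hσ : σ ≠ 0) {f : κ → Ω → ℝ}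
    (hlaw : ∀ k, HasLaw (f k) (gaussianReal 0 (σ ^ 2)) μ) (hindep : iIndepFun f μ) :
    μ.map (fun ω => WithLp.toLp 2 fun k => f k ω / σ) = stdGaussian (EuclideanSpace ℝ κ) := by
  have hσ' : (σ : ℝ) ≠ 0 := by exact_mod_cast hσ
  have hl : ∀ k, HasLaw (fun ω => f k ω / σ) (gaussianReal 0 1) μ := fun k => by
    have h := gaussianReal_div_const (hlaw k) σ
    have e : (σ ^ 2 / .mk ((σ : ℝ) ^ 2) (sq_nonneg _) : NNReal) = 1 := by
      ext; push_cast; exact div_self (pow_ne_zero 2 hσ')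
    rwa [zero_div, e] at h
  have hi : iIndepFun (fun k ω => f k ω / σ) μ :=
    hindep.comp (fun _ x => x / σ) fun _ => by fun_prop
  have hm := hi.map_fun_eq_pi_map fun k => (hl k).aemeasurable
  simp_rw [fun k => (hl k).map_eq] at hm
  rw [← map_pi_eq_stdGaussian, ← hm, AEMeasurable.map_map_of_aemeasurable (by fun_prop)
    (aemeasurable_pi_lambda _ fun k => (hl k).aemeasurable)]
  rfl

theorem level_le_one {m : ℕ} {t : ℝ} : level m t ≤ 1 := by
  unfold level
  have : 0 ≤ 1 / √(2 * Real.pi * Zfun m t) * Real.exp (-(Zfun m t / 2)) := by positivity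
  linarith

/-- The projection of Gaussian noise on a subspace of dimension at most `m` has squared norm
above `σ² (m + t)` with probability at most `1 - level m t`. -/
theorem measureReal_lt_norm_orthogonalProjectionOnto_sq_le {κ Ω : Type*} [Fintype κ]
    [MeasurableSpace Ω] {μ : Measure Ω} [IsProbabilityMeasure μ] {σ : NNReal} {f : κ → Ω → ℝ}
    (hlaw : ∀ k, HasLaw (f k) (gaussianReal 0 (σ ^ 2)) μ) (hindep : iIndepFun f μ)
    (V : Submodule ℝ (EuclideanSpace ℝ κ)) {m : ℕ} (hm : 0 < m) (hV : Module.finrank ℝ V ≤ m)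
    {t : ℝ} (ht : 0 < t) :
    μ.real {ω | σ ^ 2 * (m + t) < ‖V.orthogonalProjectionOnto (WithLp.toLp 2 fun k => f k ω)‖ ^ 2} ≤
      1 - level m t := by
  have hlev : 0 ≤ 1 - level m t := sub_nonneg.2 level_le_one
  have hmt : (m : ℝ) < m + t := by linarith
  -- The tail bound needs a nontrivial space, and the rescaling below needs `σ ≠ 0`; both degenerate
  -- cases have a null bad event.
  rcases Nat.eq_zero_or_pos (Module.finrank ℝ V) with hr | hr
  · have : Subsingleton V := Module.finrank_zero_iff.1 hr
    have e : ∀ x : EuclideanSpace ℝ κ, ‖V.orthogonalProjectionOnto x‖ = 0 := fun x => by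
      rw [Subsingleton.elim (V.orthogonalProjectionOnto x) 0, norm_zero]
    simp_rw [e]
    have : {ω : Ω | (σ : ℝ) ^ 2 * (m + t) < 0 ^ 2} = ∅ := by
      ext ω
      simp only [Set.mem_ofPred_eq, Set.mem_empty_iff_false, iff_false, not_lt]
      rw [zero_pow two_ne_zero]
      positivity
    rw [this, measureReal_empty]
    exact hlev
  rcases eq_or_ne σ 0 with rfl | hσ
  · have h0 : ∀ᵐ ω ∂μ, ∀ k, f k ω = 0 := by
      rw [ae_all_iff]
      intro k
      have h := (hlaw k).map_eq
      rw [zero_pow two_ne_zero, gaussianReal_zero_var] at h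
      refine ae_of_ae_map (p := fun x => x = 0) (hlaw k).aemeasurable ?_
      rw [h]
      exact (ae_dirac_iff (p := fun x : ℝ => x = 0) (measurableSet_singleton 0)).2 rfl
    rw [measureReal_def, measure_eq_zero_iff_ae_notMem.2, ENNReal.toReal_zero]
    · exact hlev
    · filter_upwards [h0] with ω hω
      have : (WithLp.toLp 2 fun k => f k ω : EuclideanSpace ℝ κ) = 0 := by
        ext k; simp [hω k]
      simp [this]
  have hσ' : (0 : ℝ) < σ := by exact_mod_cast pos_iff_ne_zero.2 hσ
  have : Nontrivial V := Module.nontrivial_of_finrank_pos hr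
  have hset : {ω | σ ^ 2 * (m + t) <
      ‖V.orthogonalProjectionOnto (WithLp.toLp 2 fun k => f k ω)‖ ^ 2} =
      (fun ω => WithLp.toLp 2 fun k => f k ω / σ) ⁻¹'
        (V.orthogonalProjectionOnto ⁻¹' {v : V | m + t < ‖v‖ ^ 2}) := by
    ext ω
    have e : (WithLp.toLp 2 fun k => f k ω : EuclideanSpace ℝ κ) =
        (σ : ℝ) • WithLp.toLp 2 fun k => f k ω / σ := by
      ext k; simp [mul_div_cancel₀ _ hσ'.ne']
    simp only [Set.mem_ofPred_eq, Set.mem_preimage]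
    rw [e, map_smul, norm_smul, mul_pow, Real.norm_eq_abs, sq_abs]
    exact mul_lt_mul_iff_right₀ (by positivity)
  have hmeas : MeasurableSet {v : V | m + t < ‖v‖ ^ 2} :=
    measurableSet_lt (by fun_prop) (by fun_prop)
  have haem : AEMeasurable (fun ω => (WithLp.toLp 2 fun k => f k ω / σ : EuclideanSpace ℝ κ)) μ :=
    (by fun_prop : Measurable (WithLp.toLp 2 : (κ → ℝ) → EuclideanSpace ℝ κ)).comp_aemeasurable
      (aemeasurable_pi_lambda _ fun k => (hlaw k).aemeasurable.div_const _)
  rw [hset, measureReal_def, ← Measure.map_apply_of_aemeasurable haem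
    (hmeas.preimage (by fun_prop)), map_toLp_div_eq_stdGaussian hσ hlaw hindep,
    ← Measure.map_apply (by fun_prop) hmeas, stdGaussian_map_orthogonalProjectionOnto,
    ← measureReal_def]
  have hVr : (Module.finrank ℝ V : ℝ) ≤ m := by exact_mod_cast hV
  exact (stdGaussian_real_lt_norm_sq_le (by linarith)).trans
    ((chiSqTailBound_mono hr hV hmt).trans (chiSqTailBound_le_one_sub_level hm ht))

/-- A vector of `V` only sees the projection of `e`; then Cauchy–Schwarz. -/
theorem two_mul_dotProduct_le {κ : Type*} [Fintype κ] {V : Submodule ℝ (EuclideanSpace ℝ κ)}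
    {e v : κ → ℝ} (hv : WithLp.toLp 2 v ∈ V) {α : ℝ} (hα : 0 ≤ α)
    (he : ‖V.orthogonalProjectionOnto (WithLp.toLp 2 e)‖ ^ 2 ≤ (α / 2) ^ 2) :
    2 * (e ⬝ᵥ v) ≤ α * l2 v := by
  have h1 : e ⬝ᵥ v = inner ℝ (V.orthogonalProjectionOnto (WithLp.toLp 2 e)) ⟨_, hv⟩ := by
    rw [Submodule.inner_orthogonalProjectionOnto_eq_of_mem_right]
    simp [dotProduct, PiLp.inner_apply, mul_comm]
  have h2 := real_inner_le_norm (V.orthogonalProjectionOnto (WithLp.toLp 2 e)) ⟨_, hv⟩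
  have h3 : ‖V.orthogonalProjectionOnto (WithLp.toLp 2 e)‖ ≤ α / 2 :=
    (sq_le_sq₀ (norm_nonneg _) (by positivity)).1 he
  have h4 : ‖(⟨_, hv⟩ : V)‖ = l2 v := by rw [l2_eq_norm]; rfl
  rw [h4] at h2
  rw [h1]
  have := mul_le_mul_of_nonneg_right h3 (l2_nonneg v)
  linarith

theorem probAtLeast_of_ae_imp {Ω : Type*} [MeasurableSpace Ω] {μ : Measure Ω}
    [IsProbabilityMeasure μ] {A B : Set Ω} {p : ℝ} (hB : μ.real B ≤ 1 - p)
    (h : ∀ᵐ ω ∂μ, ω ∉ B → ω ∈ A) : ProbAtLeast μ A p := by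
  -- The measurable hull of `Aᶜ` has the same measure as `Aᶜ`, so its complement is a measurable
  -- event inside `A` that is large enough.
  refine ⟨(toMeasurable μ Aᶜ)ᶜ, ?_, (measurableSet_toMeasurable μ _).compl, ?_⟩
  · exact Set.compl_subset_comm.1 (subset_toMeasurable μ _)
  · have hle : μ Aᶜ ≤ μ B := measure_mono_ae (by
      filter_upwards [h] with ω hω hA
      by_contra hωB
      exact hA (hω hωB))
    have hle' : μ.real Aᶜ ≤ μ.real B := ENNReal.toReal_mono (measure_ne_top _ _) hle
    rw [probReal_compl_eq_one_sub (measurableSet_toMeasurable μ _),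
      measureReal_def μ (toMeasurable _ _), measure_toMeasurable, ← measureReal_def]
    linarith

/-- The column space of the design matrix. -/
noncomputable def columnSpace {d na : ℕ} {nu : Fin na → ℕ} {n : Task nu → ℕ}
    (X : ∀ c : Task nu, Matrix (Fin (n c)) (Fin d) ℝ) :
    Submodule ℝ (EuclideanSpace ℝ (Σ c : Task nu, Fin (n c))) :=
  LinearMap.range ((WithLp.linearEquiv 2 ℝ _).symm.toLinearMap ∘ₗ (bigX X).mulVecLin)

theorem toLp_mulVec_mem_columnSpace {d na : ℕ} {nu : Fin na → ℕ} {n : Task nu → ℕ}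
    (X : ∀ c : Task nu, Matrix (Fin (n c)) (Fin d) ℝ) (v : (Σ _ : Task nu, Fin d) → ℝ) :
    WithLp.toLp 2 (bigX X *ᵥ v) ∈ columnSpace X :=
  ⟨v, rfl⟩

theorem finrank_columnSpace_le {d na : ℕ} {nu : Fin na → ℕ} {n : Task nu → ℕ}
    (X : ∀ c : Task nu, Matrix (Fin (n c)) (Fin d) ℝ) :
    Module.finrank ℝ (columnSpace X) ≤ d * numTasks nu := by
  refine (LinearMap.finrank_range_le _).trans ?_
  rw [Module.finrank_fintype_fun_eq_card, Fintype.card_sigma]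
  simp only [Fintype.card_fin, Finset.sum_const, Finset.card_univ, card_task, smul_eq_mul]
  rw [mul_comm]

end MultiTask

/-! ### Combination of the deterministic and probabilistic bounds -/

theorem theorem1
    {d na : ℕ} (hd : 0 < d) (hna : 0 < na)
    (nu : Fin na → ℕ) (hnu : ∀ i, 0 < nu i)
    (n : MultiTask.Task nu → ℕ)
    -- feature matrices, with columns of unit norm
    (X : ∀ c : MultiTask.Task nu, Matrix (Fin (n c)) (Fin d) ℝ)
    (hX : ∀ c l, ∑ k, X c k l ^ 2 = 1)
    -- true parameters and noise
    (Wstar : MultiTask.Params d nu)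
    {Ω : Type*} [MeasurableSpace Ω] (μ : Measure Ω) [IsProbabilityMeasure μ]
    (σ : NNReal) (noise : (Σ c : MultiTask.Task nu, Fin (n c)) → Ω → ℝ)
    (hnoise : MultiTask.IsGaussianNoise μ noise σ)
    -- level and regularisation parameters
    (t : ℝ) (ht : 0 < t) (α : ℝ)
    (hα : α = 2 * σ * √((d * MultiTask.numTasks nu : ℕ) + t))
    (lam1 lam2 lam3 : ℝ)
    (hlam1 : MultiTask.numTasks nu * α ≤ lam1)
    (hlam2 : MultiTask.nTilde nu * α ≤ lam2)
    (hlam3 : α ≤ lam3)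
    -- sparsity bounds, restricted eigenvalue constants and cone constants
    (nθ np nua : ℕ)
    (hnθ : (MultiTask.nonzeroSet Wstar.θ).card ≤ nθ)
    (hnp : (MultiTask.nonzeroSet Wstar.P).card ≤ np)
    (hnua : (MultiTask.nonzeroSet Wstar.Uᵀ).card ≤ nua)
    (bθ bp bu : ℝ) (hbθ : 0 < bθ) (hbp : 0 < bp) (hbu : 0 < bu)
    (kθ kp ku : ℝ)
    (hk : MultiTask.RestrictedEigenvalues X Wstar bθ bp bu kθ kp ku)
    -- an optimal solution, whose estimation error satisfies the cone conditions
    (What : Ω → MultiTask.Params d nu)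
    (hopt : ∀ᵐ ω ∂μ, MultiTask.IsOptimal X
      (MultiTask.response X Wstar fun k => noise k ω) lam1 lam2 lam3 (What ω))
    (hcone : ∀ᵐ ω ∂μ, What ω - Wstar ∈ MultiTask.cone Wstar bθ bp bu)
    (ζ : ℝ)
    (hζ : ζ = lam1 * √nθ / kθ + lam2 * √np / kp + lam3 * √nua / ku)
    -- `N = n_min n_u`
    (N : ℝ) (hN : N = MultiTask.nMin n * MultiTask.numTasks nu) :
    MultiTask.ProbAtLeast μ
      {ω | 1 / N * MultiTask.l2 (MultiTask.bigX X *ᵥ (What ω).stack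
          - MultiTask.bigX X *ᵥ Wstar.stack) ^ 2 ≤ (2 * ζ / N) ^ 2}
      (MultiTask.level (d * MultiTask.numTasks nu) t) ∧
    MultiTask.ProbAtLeast μ
      {ω | MultiTask.l1 ((What ω).θ - Wstar.θ) ≤ 2 * (bθ + 1) * √nθ / (kθ * N) * ζ}
      (MultiTask.level (d * MultiTask.numTasks nu) t) ∧
    MultiTask.ProbAtLeast μ
      {ω | MultiTask.l12 ((What ω).P - Wstar.P) ≤ 2 * (bp + 1) * √np / (kp * N) * ζ}
      (MultiTask.level (d * MultiTask.numTasks nu) t) ∧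
    MultiTask.ProbAtLeast μ
      {ω | MultiTask.l12 ((What ω).Uᵀ - Wstar.Uᵀ) ≤ 2 * (bu + 1) * √nua / (ku * N) * ζ}
      (MultiTask.level (d * MultiTask.numTasks nu) t) := by
  have hα0 : 0 ≤ α := by rw [hα]; positivity
  have : Nonempty (MultiTask.Task nu) := ⟨⟨⟨0, hna⟩, ⟨0, hnu _⟩⟩⟩
  have hT : 0 < MultiTask.numTasks nu := by
    rw [← MultiTask.card_task]; exact Fintype.card_pos
  have hN0 : 0 < (MultiTask.nMin n : ℝ) * MultiTask.numTasks nu := by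
    have := MultiTask.nMin_pos hd hX
    positivity
  have hm : 0 < d * MultiTask.numTasks nu := Nat.mul_pos hd hT
  have hB := MultiTask.measureReal_lt_norm_orthogonalProjectionOnto_sq_le hnoise.law hnoise.indep
    (MultiTask.columnSpace X) hm (MultiTask.finrank_columnSpace_le X) ht
  -- The choice of `α` makes the correlation threshold coincide with the tail threshold.
  have hα2 : (α / 2) ^ 2 = σ ^ 2 * ((d * MultiTask.numTasks nu : ℕ) + t) := by
    rw [hα, mul_assoc, mul_div_cancel_left₀ _ two_ne_zero, mul_pow, Real.sq_sqrt (by positivity)]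
  rw [← hα2] at hB
  -- Outside one common bad event all four bounds hold at once.
  have hgood := (hopt.and hcone).mono fun ω hω (hωB : ω ∉ {ω | (α / 2) ^ 2 <
      ‖(MultiTask.columnSpace X).orthogonalProjectionOnto
        (WithLp.toLp 2 fun k => noise k ω)‖ ^ 2}) =>
    hω.1.error_bounds hd hna hX hN0 hα0
      (fun Γ => MultiTask.two_mul_dotProduct_le (e := fun k => noise k ω)
        (MultiTask.toLp_mulVec_mem_columnSpace X Γ.stack) hα0
        (by simpa only [Set.mem_ofPred_eq, not_lt] using hωB))
      hlam1 hlam2 hlam3 hnθ hnp hnua hbθ hbp hbu hk hω.2 hζ hN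
  refine ⟨MultiTask.probAtLeast_of_ae_imp hB ?_, MultiTask.probAtLeast_of_ae_imp hB ?_,
    MultiTask.probAtLeast_of_ae_imp hB ?_, MultiTask.probAtLeast_of_ae_imp hB ?_⟩
  · filter_upwards [hgood] with ω h hω using (h hω).1
  · filter_upwards [hgood] with ω h hω using (h hω).2.1
  · filter_upwards [hgood] with ω h hω using (h hω).2.2.1
  · filter_upwards [hgood] with ω h hω using (h hω).2.2.2
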